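/- Let $n\ge 1$ and let $X_1,\dots,X_n$ be random vectors in $\mathbb R^d$ forming a martingale difference sequence adapted to a filtration $\mathcal F_0\subseteq\mathcal F_1\subseteq\dots\subseteq\mathcal F_n$, that is, $X_k$ is integrable and $\mathcal F_k$-measurable and $E[X_k\mid\mathcal F_{k-1}]=0$ almost surely for $1\le k\le n$. Put $V_k=E[X_kX_k^{\top}\mid\mathcal F_{k-1}]$, $S_n=\sum_{k=1}^nX_k$ and $\Sigma=\operatorname{Var}(S_n)$ (the covariance matrix), and assume that $\sum_{k=1}^nV_k=\Sigma$ almost surely. Let $\alpha>0$ and $\beta,\gamma$ be real constants such that, for every $k\in\{1,\dots,n\}$, $\alpha I\preceq V_k\preceq\beta I$ almost surely ($\preceq$ being the positive semidefinite order) and $E\|X_k\|_2^3\le\gamma d^{3/2}$ (in particular, this moment is finite). Let $Z\sim\mathcal N_d(0,I)$, let $h:\mathbb R^d\to\mathbb R$ be twice differentiable, and let $$M_2(h)=\sup_{x\ne y}\frac{\|\nabla h(x)-\nabla h(y)\|_2}{\|x-y\|_2}\in[0,\infty].$$ If $M_2(h)<\infty$, then $h(\Sigma^{-1/2}S_n)$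 and $h(Z)$ are integrable and $$\bigl|E\,h(\Sigma^{-1/2}S_n)-E\,h(Z)\bigr|\le\frac{3\pi\gamma\sqrt\beta}{4\alpha^2}\,M_2(h)\,\frac{d^2}{\sqrt n}.$$ (If $M_2(h)=\infty$, the right-hand side is $+\infty$ and the bound is void.) -/

import Mathlib

open MeasureTheory ProbabilityTheory
open scoped ENNReal Matrix MatrixOrder Gradient

noncomputable section

namespace MartingaleCLT

/-- `X 1, …, X n` is a martingale difference sequence in `ℝᵈ` adapted to `ℱ 0 ≤ … ≤ ℱ n`:
for `1 ≤ k ≤ n`, `X k` is `ℱ k`-measurable, integrable, and `E[X k | ℱ (k-1)] = 0` a.s.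
(The values of `X` and `ℱ` at other indices play no role.) -/
structure IsMartingaleDifference {Ω : Type*} {mΩ : MeasurableSpace Ω} {d : ℕ} (n : ℕ)
    (X : ℕ → Ω → EuclideanSpace ℝ (Fin d)) (ℱ : Filtration ℕ mΩ) (P : Measure Ω) : Prop where
  adapted : ∀ k ∈ Finset.Icc 1 n, StronglyMeasurable[ℱ k] (X k)
  integrable : ∀ k ∈ Finset.Icc 1 n, Integrable (X k) P
  condExp_eq_zero : ∀ k ∈ Finset.Icc 1 n, P[X k | ℱ (k - 1)] =ᵐ[P] 0

/-- The conditional covariance `V k = E[X k (X k)ᵀ | ℱ (k-1)]`, a random `d × d` matrix,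
with the conditional expectation taken entrywise. -/
def condCov {Ω : Type*} {mΩ : MeasurableSpace Ω} {d : ℕ}
    (X : ℕ → Ω → EuclideanSpace ℝ (Fin d)) (ℱ : Filtration ℕ mΩ) (P : Measure Ω)
    (k : ℕ) (ω : Ω) : Matrix (Fin d) (Fin d) ℝ :=
  Matrix.of fun i j => (P[fun ω' => X k ω' i * X k ω' j | ℱ (k - 1)]) ω

/-- The sum `S n = X 1 + ⋯ + X n`. -/
def partialSum {Ω : Type*} {d : ℕ} (X : ℕ → Ω → EuclideanSpace ℝ (Fin d)) (n : ℕ) (ω : Ω) :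
    EuclideanSpace ℝ (Fin d) :=
  ∑ k ∈ Finset.Icc 1 n, X k ω

/-- The covariance matrix `Var(Y)` of a random vector `Y` in `ℝᵈ`. -/
def covMat {Ω : Type*} {mΩ : MeasurableSpace Ω} {d : ℕ}
    (Y : Ω → EuclideanSpace ℝ (Fin d)) (P : Measure Ω) : Matrix (Fin d) (Fin d) ℝ :=
  Matrix.of fun i j => cov[fun ω => Y ω i, fun ω => Y ω j; P]

/-- The linear map `x ↦ A^{-1/2} x` on `ℝᵈ`, for a positive definite matrix `A`;
`CFC.sqrt A` is the positive semidefinite square root of `A`. -/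
def invSqrtMul {d : ℕ} (A : Matrix (Fin d) (Fin d) ℝ) (x : EuclideanSpace ℝ (Fin d)) :
    EuclideanSpace ℝ (Fin d) :=
  Matrix.toEuclideanCLM (𝕜 := ℝ) (CFC.sqrt A)⁻¹ x

/-- `M₂(h) = sup_{x ≠ y} ‖∇h(x) - ∇h(y)‖ / ‖x - y‖`, with values in `[0, ∞]`. -/
def M₂ {d : ℕ} (h : EuclideanSpace ℝ (Fin d) → ℝ) : ℝ≥0∞ :=
  ⨆ (x : EuclideanSpace ℝ (Fin d)) (y : EuclideanSpace ℝ (Fin d)) (_ : x ≠ y),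
    ‖∇ h x - ∇ h y‖ₑ / ‖x - y‖ₑ

end MartingaleCLT

end

/-!
The proof is Lindeberg's replacement method, run on a Gaussian scale that is adapted to the
martingale. Put `f x = h (Σ^{-1/2} x)`, so that `∇f` is Lipschitz with constant
`M = M₂ h / (n α)`, and let `Q k = Σ - (V 1 + ⋯ + V k)`. Since `∑ V k = Σ`, the matrix `Q k` is
known at time `k - 1`, it dominates `(n - k) α I`, and `Q n = 0`. With
`U R x = ∫ f (x + y) dN(0, R)(y)` (`gaussianAverage`), the difference to be bounded telescopes as
`∑ E [U (Q k) (S k) - U (Q (k - 1)) (S (k - 1))]`. Here `Q (k - 1) = Q k + V k`, and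
`N(0, Q k + V k)` is the convolution of `N(0, Q k)` and `N(0, V k)`, so each summand compares the
increment `X k` with a Gaussian increment that has the same conditional mean and covariance, both
tested against the smoothed function `U (Q k)`.

Smoothing with a covariance of at least `r I` makes the second derivative Lipschitz with constant
`M / √r` (`abs_integral_fderiv_fderiv_sub_le`): in a fixed direction `w` the Gaussian splits off an
independent one-dimensional Gaussian, and Stein's identity moves one derivative onto it. Hence `U R`
has a second order Taylor expansion with a cubic remainder (`abs_gaussianAverage_sub_le`). The
terms of order one and two vanish in expectation because their coefficients are known at time
`k - 1` (`IsMartingaleStep.integral_linear_term`, `IsMartingaleStep.integral_quadratic_term`). The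
remainder costs `M (1 + √3) / (6 √r) · E‖X k‖³`: the third moment of `N(0, V)` is at most
`√3 (tr V)^{3/2}`, and `E (tr V k)^{3/2} ≤ E‖X k‖³` by a conditional Jensen inequality.

For `k = n` nothing is left to smooth with. There a first order expansion gives
`M E (tr V n) ≤ M E‖X n‖³ / √α`. Summing `1 / √((n - k) α)` over `k < n` yields at most
`2 √(n / α)`, and the
numerical constants stay below `3 π / 4` (`sum_step_weights_le`).
-/

namespace MartingaleCLT

/-! ### Stein's identity and moments of the standard normal law -/

theorem hasDerivAt_gaussianPDFReal_zero_one (s : ℝ) :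
    HasDerivAt (gaussianPDFReal 0 1) (-s * gaussianPDFReal 0 1 s) s := by
  have h1 : HasDerivAt (fun x : ℝ => -(x - 0) ^ 2 / (2 * ((1 : NNReal) : ℝ))) (-s) s := by
    have := (((hasDerivAt_id s).sub_const 0).pow 2).neg.div_const (2 * ((1 : NNReal) : ℝ))
    refine this.congr_deriv ?_
    simp
    ring
  have h2 := (h1.exp).const_mul ((√(2 * Real.pi * (1 : NNReal)))⁻¹)
  refine h2.congr_deriv ?_
  simp only [gaussianPDFReal]
  ring

theorem integrable_gaussianReal_zero_one_iff {F : ℝ → ℝ} :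
    Integrable F (gaussianReal 0 1) ↔ Integrable (fun s => gaussianPDFReal 0 1 s * F s) := by
  rw [gaussianReal_of_var_ne_zero _ one_ne_zero,
    integrable_withDensity_iff_integrable_smul' (measurable_gaussianPDF _ _)
      (ae_of_all _ fun _ => gaussianPDF_lt_top)]
  simp [toReal_gaussianPDF]

/-- **Stein's identity** for the standard normal distribution. -/
theorem integral_deriv_gaussianReal {F F' : ℝ → ℝ} (hF : ∀ s, HasDerivAt F (F' s) s)
    (h0 : Integrable F (gaussianReal 0 1)) (h1 : Integrable F' (gaussianReal 0 1))
    (h2 : Integrable (fun s => s * F s) (gaussianReal 0 1)) :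
    ∫ s, F' s ∂(gaussianReal 0 1) = ∫ s, s * F s ∂(gaussianReal 0 1) := by
  rw [integral_gaussianReal_eq_integral_smul one_ne_zero,
    integral_gaussianReal_eq_integral_smul one_ne_zero]
  rw [integrable_gaussianReal_zero_one_iff] at h0 h1 h2
  have := integral_mul_deriv_eq_deriv_mul_of_integrable
    (u := gaussianPDFReal 0 1) (v := F) (u' := fun s => -s * gaussianPDFReal 0 1 s) (v' := F')
    (fun s _ => hasDerivAt_gaussianPDFReal_zero_one s) (fun s _ => hF s) h1
    (by refine h2.neg.congr (ae_of_all _ fun s => ?_); simp only [Pi.neg_apply, Pi.mul_apply]; ring)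
    h0
  simp only [smul_eq_mul]
  rw [this, ← integral_neg]
  congr 1
  ext s
  ring

theorem integrable_pow_gaussianReal (k : ℕ) :
    Integrable (fun s : ℝ => s ^ k) (gaussianReal 0 1) := by
  have h := (memLp_id_gaussianReal (μ := 0) (v := 1) k).integrable_norm_pow' 
  refine (h.mono' (by fun_prop) (ae_of_all _ fun s => ?_))
  simp

theorem integral_sq_gaussianReal : ∫ s, s ^ 2 ∂(gaussianReal 0 1) = 1 := by
  have := integral_deriv_gaussianReal (F := fun s => s) (F' := fun _ => 1) (fun s => hasDerivAt_id s)
    (by simpa using integrable_pow_gaussianReal 1) (integrable_const _)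
    (by simpa [← pow_two] using integrable_pow_gaussianReal 2)
  simpa [← pow_two] using this.symm

theorem integral_pow_four_gaussianReal : ∫ s, s ^ 4 ∂(gaussianReal 0 1) = 3 := by
  have := integral_deriv_gaussianReal (F := fun s => s ^ 3) (F' := fun s => 3 * s ^ 2)
    (fun s => by simpa using hasDerivAt_pow 3 s)
    (integrable_pow_gaussianReal 3) ((integrable_pow_gaussianReal 2).const_mul 3)
    (by simpa [← pow_succ'] using integrable_pow_gaussianReal 4)
  rw [integral_const_mul, integral_sq_gaussianReal] at this
  simp only [← pow_succ'] at this
  linarith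

theorem integral_abs_gaussianReal_le_one : ∫ s, |s| ∂(gaussianReal 0 1) ≤ 1 := by
  have h1 : Integrable (fun s : ℝ => |s|) (gaussianReal 0 1) := by
    simpa using (integrable_pow_gaussianReal 1).abs
  calc ∫ s, |s| ∂(gaussianReal 0 1) ≤ ∫ s, (1 + s ^ 2) / 2 ∂(gaussianReal 0 1) := by
        refine integral_mono h1 (((integrable_const 1).add (integrable_pow_gaussianReal 2)).div_const 2)
          fun s => ?_
        nlinarith [sq_nonneg (|s| - 1), sq_abs s]
    _ = 1 := by
        rw [integral_div, integral_add (integrable_const 1) (integrable_pow_gaussianReal 2),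
          integral_sq_gaussianReal]
        simp

/-! ### Convolution of multivariate Gaussian laws -/

section Multivariate

variable {d : ℕ}

theorem multivariateGaussian_zero_add {R V : Matrix (Fin d) (Fin d) ℝ} (hR : R.PosSemidef)
    (hV : V.PosSemidef) :
    multivariateGaussian 0 (R + V) =
      ((multivariateGaussian 0 R).prod (multivariateGaussian 0 V)).map (fun p => p.1 + p.2) := by
  refine Measure.ext_of_charFun (funext fun t => ?_)
  rw [charFun_map_add_prod_eq_mul, charFun_multivariateGaussian (hR.add hV), Pi.mul_apply,
    charFun_multivariateGaussian hR, charFun_multivariateGaussian hV, ← Complex.exp_add]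
  congr 1
  simp only [inner_zero_right, Matrix.add_mulVec, dotProduct_add]
  push_cast
  ring

theorem multivariateGaussian_rankOne (w : EuclideanSpace ℝ (Fin d)) :
    multivariateGaussian 0 (Matrix.vecMulVec w w) =
      (gaussianReal 0 1).map (fun s : ℝ => s • w) := by
  have hw : (Matrix.vecMulVec w w : Matrix (Fin d) (Fin d) ℝ).PosSemidef := by
    simpa using Matrix.posSemidef_vecMulVec_self_star (R := ℝ) (w : Fin d → ℝ)
  refine Measure.ext_of_charFun (funext fun t => ?_)
  rw [charFun_multivariateGaussian hw, charFun_apply, integral_map (by fun_prop) (by fun_prop)]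
  simp_rw [real_inner_smul_left, mul_comm _ (inner ℝ w t)]
  have := charFun_gaussianReal (μ := 0) (v := 1) (inner ℝ w t)
  rw [charFun_apply_real] at this
  simp only [Complex.ofReal_mul]
  rw [this]
  congr 1
  have : t ⬝ᵥ (Matrix.vecMulVec w w) *ᵥ t = (inner ℝ w t) ^ 2 := by
    have h : inner ℝ w t = w.ofLp ⬝ᵥ t.ofLp := by simp [PiLp.inner_apply, dotProduct, mul_comm]
    rw [Matrix.vecMulVec_mulVec, op_smul_eq_smul, dotProduct_smul, h, dotProduct_comm t.ofLp,
      pow_two, smul_eq_mul]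
  rw [this]
  simp

/-- The Gaussian with covariance `R` splits off an independent Gaussian in the direction `w`
as soon as `R - w wᵀ` is positive semidefinite. -/
theorem multivariateGaussian_eq_map_add_smul {R : Matrix (Fin d) (Fin d) ℝ}
    {w : EuclideanSpace ℝ (Fin d)} (hR : (R - Matrix.vecMulVec w w).PosSemidef) :
    multivariateGaussian 0 R =
      ((multivariateGaussian 0 (R - Matrix.vecMulVec w w)).prod (gaussianReal 0 1)).map
        (fun p => p.1 + p.2 • w) := by
  have hw : (Matrix.vecMulVec w w : Matrix (Fin d) (Fin d) ℝ).PosSemidef := by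
    simpa using Matrix.posSemidef_vecMulVec_self_star (R := ℝ) (w : Fin d → ℝ)
  have h := multivariateGaussian_zero_add hR hw
  rw [sub_add_cancel, multivariateGaussian_rankOne] at h
  rw [← Measure.map_id (μ := multivariateGaussian 0 (R - Matrix.vecMulVec w w))] at h
  rw [Measure.map_prod_map _ _ measurable_id (by fun_prop), Measure.map_map (by fun_prop)
    (by fun_prop)] at h
  exact h

end Multivariate

/-! ### Taylor expansion on the unit interval -/

section Taylor

theorem abs_taylor_one_le {φ φ' : ℝ → ℝ} (hφ : ∀ t, HasDerivAt φ (φ' t) t) {K : ℝ}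
    (hK : ∀ t, 0 ≤ t → |φ' t - φ' 0| ≤ K * t) : |φ 1 - φ 0 - φ' 0| ≤ K / 2 := by
  have hd : ∀ t, HasDerivAt (fun t => φ t - φ 0 - t * φ' 0) (φ' t - φ' 0) t := fun t => by
    exact (((hφ t).sub_const (φ 0)).sub ((hasDerivAt_id t).mul_const (φ' 0))).congr_deriv (by simp)
  have hB : ∀ t : ℝ, HasDerivAt (fun t => K / 2 * t ^ 2) (K * t) t := fun t =>
    ((hasDerivAt_pow 2 t).const_mul (K / 2)).congr_deriv (by simp; ring)
  have := image_norm_le_of_norm_deriv_right_le_deriv_boundary (a := 0) (b := 1)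
    (fun t _ => (hd t).continuousAt.continuousWithinAt) (fun t _ => (hd t).hasDerivWithinAt)
    (by simp) hB (fun t ht => hK t ht.1) (x := 1) (by simp)
  simpa using this

theorem abs_taylor_two_le {φ φ' φ'' : ℝ → ℝ} (hφ : ∀ t, HasDerivAt φ (φ' t) t)
    (hφ' : ∀ t, HasDerivAt φ' (φ'' t) t) {K : ℝ}
    (hK : ∀ t, 0 ≤ t → |φ'' t - φ'' 0| ≤ K * t) :
    |φ 1 - φ 0 - φ' 0 - φ'' 0 / 2| ≤ K / 6 := by
  have hd' : ∀ t, HasDerivAt (fun t => φ' t - φ' 0 - t * φ'' 0) (φ'' t - φ'' 0) t := fun t => by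
    exact (((hφ' t).sub_const (φ' 0)).sub ((hasDerivAt_id t).mul_const (φ'' 0))).congr_deriv
      (by simp)
  have hB' : ∀ t : ℝ, HasDerivAt (fun t => K / 2 * t ^ 2) (K * t) t := fun t =>
    ((hasDerivAt_pow 2 t).const_mul (K / 2)).congr_deriv (by simp; ring)
  have h1 : ∀ t, 0 ≤ t → |φ' t - φ' 0 - t * φ'' 0| ≤ K / 2 * t ^ 2 := fun s hs =>
    image_norm_le_of_norm_deriv_right_le_deriv_boundary (a := 0) (b := s)
      (fun t _ => (hd' t).continuousAt.continuousWithinAt) (fun t _ => (hd' t).hasDerivWithinAt)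
      (by simp) hB' (fun t ht => hK t ht.1) (x := s) (by simpa using hs)
  have hd : ∀ t, HasDerivAt (fun t => φ t - φ 0 - t * φ' 0 - t ^ 2 * (φ'' 0 / 2))
      (φ' t - φ' 0 - t * φ'' 0) t := fun t =>
    ((((hφ t).sub_const (φ 0)).sub ((hasDerivAt_id t).mul_const (φ' 0))).sub
      ((hasDerivAt_pow 2 t).mul_const (φ'' 0 / 2))).congr_deriv (by simp; ring)
  have hB : ∀ t : ℝ, HasDerivAt (fun t => K / 6 * t ^ 3) (K / 2 * t ^ 2) t := fun t =>
    ((hasDerivAt_pow 3 t).const_mul (K / 6)).congr_deriv (by simp; ring)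
  have := image_norm_le_of_norm_deriv_right_le_deriv_boundary (a := 0) (b := 1)
    (fun t _ => (hd t).continuousAt.continuousWithinAt) (fun t _ => (hd t).hasDerivWithinAt)
    (by simp) hB (fun t ht => h1 t ht.1) (x := 1) (by simp)
  simpa using this

end Taylor

/-! ### Functions with Lipschitz derivative -/

/-- A twice differentiable function whose derivative is Lipschitz with constant `M`. The second
derivative then exists everywhere and is bounded by `M`, but it need not be continuous. -/
structure HasLipschitzFDeriv {E : Type*} [NormedAddCommGroup E] [NormedSpace ℝ E]
    (f : E → ℝ) (M : NNReal) : Prop where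
  differentiable : Differentiable ℝ f
  differentiable_fderiv : Differentiable ℝ (fderiv ℝ f)
  lipschitz : LipschitzWith M (fderiv ℝ f)

namespace HasLipschitzFDeriv

variable {E : Type*} [NormedAddCommGroup E] [NormedSpace ℝ E] {f : E → ℝ} {M : NNReal}

theorem norm_fderiv_fderiv_le (hf : HasLipschitzFDeriv f M) (x : E) :
    ‖fderiv ℝ (fderiv ℝ f) x‖ ≤ M :=
  norm_fderiv_le_of_lipschitz ℝ hf.lipschitz

theorem abs_fderiv_sub_le (hf : HasLipschitzFDeriv f M) (x y u : E) :
    |fderiv ℝ f x u - fderiv ℝ f y u| ≤ M * ‖x - y‖ * ‖u‖ := by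
  rw [← _root_.sub_apply, ← Real.norm_eq_abs]
  refine (ContinuousLinearMap.le_opNorm _ _).trans ?_
  gcongr
  exact hf.lipschitz.norm_sub_le x y

theorem norm_fderiv_le (hf : HasLipschitzFDeriv f M) (x : E) :
    ‖fderiv ℝ f x‖ ≤ ‖fderiv ℝ f 0‖ + M * ‖x‖ := by
  have h := hf.lipschitz.norm_sub_le x 0
  rw [sub_zero] at h
  linarith [norm_le_norm_add_norm_sub' (fderiv ℝ f x) (fderiv ℝ f 0)]

theorem hasDerivAt_line {g : E → ℝ} (hg : Differentiable ℝ g) (x u : E) (t : ℝ) :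
    HasDerivAt (fun t : ℝ => g (x + t • u)) (fderiv ℝ g (x + t • u) u) t := by
  have h1 : HasDerivAt (fun t : ℝ => x + t • u) u t := by
    simpa using ((hasDerivAt_id t).smul_const u).const_add x
  exact (hg (x + t • u)).hasFDerivAt.comp_hasDerivAt t h1

theorem abs_sub_sub_le (hf : HasLipschitzFDeriv f M) (x u : E) :
    |f (x + u) - f x - fderiv ℝ f x u| ≤ M * ‖u‖ ^ 2 / 2 := by
  have := abs_taylor_one_le (φ := fun t : ℝ => f (x + t • u))
    (φ' := fun t => fderiv ℝ f (x + t • u) u) (K := M * ‖u‖ ^ 2)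
    (hasDerivAt_line hf.differentiable x u) (fun t ht => ?_)
  · simpa using this
  · refine (hf.abs_fderiv_sub_le _ _ _).trans (le_of_eq ?_)
    simp [norm_smul, abs_of_nonneg ht]
    ring

theorem abs_le (hf : HasLipschitzFDeriv f M) (x : E) :
    |f x| ≤ |f 0| + ‖fderiv ℝ f 0‖ * ‖x‖ + M * ‖x‖ ^ 2 / 2 := by
  have h1 := hf.abs_sub_sub_le 0 x
  have h2 := (fderiv ℝ f 0).le_opNorm x
  rw [Real.norm_eq_abs] at h2
  rw [zero_add] at h1
  have h3 := abs_add_le (f x - f 0 - fderiv ℝ f 0 x) (f 0 + fderiv ℝ f 0 x)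
  have h4 := abs_add_le (f 0) (fderiv ℝ f 0 x)
  rw [show f x - f 0 - fderiv ℝ f 0 x + (f 0 + fderiv ℝ f 0 x) = f x by ring] at h3
  linarith

theorem hasFDerivAt_fderiv_apply (hf : HasLipschitzFDeriv f M) (u x : E) :
    HasFDerivAt (fun z => fderiv ℝ f z u) ((fderiv ℝ (fderiv ℝ f) x).flip u) x :=
  (hf.differentiable_fderiv x).hasFDerivAt.clm_apply (hasFDerivAt_const u x) |>.congr_fderiv
    (by ext; simp)

theorem abs_fderiv_fderiv_apply_le (hf : HasLipschitzFDeriv f M) (x u v : E) :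
    |fderiv ℝ (fderiv ℝ f) x u v| ≤ M * ‖u‖ * ‖v‖ := by
  refine ((fderiv ℝ (fderiv ℝ f) x).le_opNorm₂ u v).trans ?_
  gcongr
  exact hf.norm_fderiv_fderiv_le x

variable {α : Type*} {mα : MeasurableSpace α} {ν : Measure α} [IsFiniteMeasure ν]

theorem integrable_comp (hf : HasLipschitzFDeriv f M) {Y : α → E} (hY : MemLp Y 2 ν) :
    Integrable (fun a => f (Y a)) ν := by
  have h1 : Integrable (fun a => ‖Y a‖) ν := (hY.integrable (by norm_num)).norm
  have h2 : Integrable (fun a => ‖Y a‖ ^ 2) ν := hY.integrable_norm_pow'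
  refine Integrable.mono' ((((integrable_const |f 0|).add (h1.const_mul ‖fderiv ℝ f 0‖)).add
    ((h2.const_mul (M : ℝ)).div_const 2)))
    (hf.differentiable.continuous.comp_aestronglyMeasurable hY.1) (ae_of_all _ fun a => ?_)
  exact hf.abs_le (Y a)

section Measure

variable [MeasurableSpace E] [BorelSpace E]

theorem measurable_fderiv_apply (f : E → ℝ) (u : E) : Measurable fun x => fderiv ℝ f x u :=
  measurable_fderiv_apply_const ℝ f u

theorem measurable_fderiv_fderiv_apply (f : E → ℝ) (u v : E) :
    Measurable fun x => fderiv ℝ (fderiv ℝ f) x u v := by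
  have h := measurable_fderiv_apply_const ℝ (fderiv ℝ f) u
  exact (ContinuousLinearMap.apply ℝ ℝ v).continuous.measurable.comp h

theorem memLp_fderiv_comp (hf : HasLipschitzFDeriv f M) {Y : α → E} {p : ℝ≥0∞} (hY : MemLp Y p ν)
    (u : E) : MemLp (fun a => fderiv ℝ f (Y a) u) p ν := by
  refine MemLp.mono' (((memLp_const ‖fderiv ℝ f 0‖).add (hY.norm.const_mul (M : ℝ))).mul_const ‖u‖)
    ((measurable_fderiv_apply f u).comp_aemeasurable hY.1.aemeasurable).aestronglyMeasurable
    (ae_of_all _ fun a => ?_)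
  refine ((fderiv ℝ f (Y a)).le_opNorm u).trans ?_
  simp only [Pi.add_apply]
  gcongr
  exact hf.norm_fderiv_le (Y a)

theorem integrable_fderiv_fderiv_comp (hf : HasLipschitzFDeriv f M) {Y : α → E}
    (hY : AEMeasurable Y ν) (u v : E) :
    Integrable (fun a => fderiv ℝ (fderiv ℝ f) (Y a) u v) ν :=
  Integrable.mono' (integrable_const (M * ‖u‖ * ‖v‖))
    ((measurable_fderiv_fderiv_apply f u v).comp_aemeasurable hY).aestronglyMeasurable
    (ae_of_all _ fun a => hf.abs_fderiv_fderiv_apply_le (Y a) u v)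

end Measure

end HasLipschitzFDeriv

/-! ### Differentiation under the integral -/

section ParametricIntegral

variable {E : Type*} [NormedAddCommGroup E] [NormedSpace ℝ E]
  [MeasurableSpace E] [BorelSpace E] {ν : Measure E} [IsFiniteMeasure ν]

theorem hasDerivAt_integral_add_smul {g : E → ℝ} (hg : Differentiable ℝ g) {C D : ℝ} (hD : 0 ≤ D)
    (hC : ∀ z, ‖fderiv ℝ g z‖ ≤ C + D * ‖z‖) (hν : Integrable id ν)
    (hint : ∀ x, Integrable (fun y => g (x + y)) ν) (x u : E) (t : ℝ) :
    HasDerivAt (fun t : ℝ => ∫ y, g (x + t • u + y) ∂ν)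
      (∫ y, fderiv ℝ g (x + t • u + y) u ∂ν) t := by
  have hcont := hg.continuous
  refine (hasDerivAt_integral_of_dominated_loc_of_deriv_le
    (F := fun t y => g (x + t • u + y)) (F' := fun t y => fderiv ℝ g (x + t • u + y) u)
    (bound := fun y => (C + D * (‖x‖ + (|t| + 1) * ‖u‖ + ‖y‖)) * ‖u‖)
    (Metric.ball_mem_nhds t one_pos) (Filter.Eventually.of_forall fun s => ?_) (hint _) ?_
    (ae_of_all _ fun y s hs => ?_) ?_ (ae_of_all _ fun y s _ => ?_)).2
  · exact (by fun_prop : Continuous fun y => g (x + s • u + y)).aestronglyMeasurable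
  · exact ((measurable_fderiv_apply_const ℝ g u).comp (by fun_prop)).aestronglyMeasurable
  · refine ((fderiv ℝ g _).le_opNorm u).trans ?_
    refine mul_le_mul_of_nonneg_right ((hC _).trans ?_) (norm_nonneg u)
    have hs' : |s| ≤ |t| + 1 := by
      rw [Metric.mem_ball, Real.dist_eq] at hs
      linarith [abs_sub_abs_le_abs_sub s t]
    gcongr
    refine (norm_add₃_le).trans ?_
    rw [norm_smul, Real.norm_eq_abs]
    gcongr
  · refine Integrable.mul_const ?_ _
    exact (integrable_const C).add (((integrable_const _).add hν.norm).const_mul D)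
  · have := HasLipschitzFDeriv.hasDerivAt_line hg (x + y) u s
    simpa only [add_right_comm x y] using this

end ParametricIntegral

/-! ### Smoothing by a multivariate Gaussian -/

section GaussianSmoothing

variable {d : ℕ} {f : EuclideanSpace ℝ (Fin d) → ℝ} {M : NNReal}

theorem posSemidef_norm_sq_smul_one_sub_vecMulVec (w : EuclideanSpace ℝ (Fin d)) :
    (‖w‖ ^ 2 • (1 : Matrix (Fin d) (Fin d) ℝ) - Matrix.vecMulVec w w).PosSemidef := by
  refine Matrix.PosSemidef.of_dotProduct_mulVec_nonneg ?_ fun x => ?_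
  · refine Matrix.IsHermitian.sub ?_ ?_
    · exact Matrix.isHermitian_one.smul (IsSelfAdjoint.all _)
    · simpa using (Matrix.posSemidef_vecMulVec_self_star (R := ℝ) (w : Fin d → ℝ)).1
  · have h1 : inner ℝ w (WithLp.toLp 2 x) = w.ofLp ⬝ᵥ x := by
      simp [PiLp.inner_apply, dotProduct, mul_comm]
    have h2 := real_inner_mul_inner_self_le w (WithLp.toLp 2 x)
    have h3 : inner ℝ (WithLp.toLp 2 x) (WithLp.toLp 2 x) = x ⬝ᵥ x := by
      rw [real_inner_self_eq_norm_sq, EuclideanSpace.real_norm_sq_eq]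
      simp [dotProduct, pow_two]
    rw [h1, h3, real_inner_self_eq_norm_sq] at h2
    simp only [star_trivial, Matrix.sub_mulVec, Matrix.smul_mulVec, Matrix.one_mulVec,
      dotProduct_sub, dotProduct_smul, Matrix.vecMulVec_mulVec, op_smul_eq_smul, smul_eq_mul]
    rw [dotProduct_comm x w.ofLp]
    linarith

theorem memLp_id_multivariateGaussian (R : Matrix (Fin d) (Fin d) ℝ) {p : ℝ≥0∞} (hp : p ≠ ∞) :
    MemLp id p (multivariateGaussian 0 R) :=
  IsGaussian.memLp_id _ p hp

theorem memLp_const_add_multivariateGaussian (R : Matrix (Fin d) (Fin d) ℝ)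
    (x : EuclideanSpace ℝ (Fin d)) {p : ℝ≥0∞} (hp : p ≠ ∞) :
    MemLp (fun y => x + y) p (multivariateGaussian 0 R) :=
  (memLp_const x).add (memLp_id_multivariateGaussian R hp)

/-- Stein's identity in the direction `w`. -/
theorem integral_fderiv_fderiv_multivariateGaussian (hf : HasLipschitzFDeriv f M)
    {R : Matrix (Fin d) (Fin d) ℝ} {w : EuclideanSpace ℝ (Fin d)}
    (hR : (R - Matrix.vecMulVec w w).PosSemidef) (x : EuclideanSpace ℝ (Fin d)) :
    Integrable (fun p : EuclideanSpace ℝ (Fin d) × ℝ => p.2 * fderiv ℝ f (x + (p.1 + p.2 • w)) w)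
      ((multivariateGaussian 0 (R - Matrix.vecMulVec w w)).prod (gaussianReal 0 1)) ∧
    ∫ y, fderiv ℝ (fderiv ℝ f) (x + y) w w ∂(multivariateGaussian 0 R) =
      ∫ p, p.2 * fderiv ℝ f (x + (p.1 + p.2 • w)) w
        ∂((multivariateGaussian 0 (R - Matrix.vecMulVec w w)).prod (gaussianReal 0 1)) := by
  have hs : MemLp (fun s : ℝ => s) 2 (gaussianReal 0 1) := memLp_id_gaussianReal 2
  have h2 : MemLp (fun p : EuclideanSpace ℝ (Fin d) × ℝ => p.2) 2
      ((multivariateGaussian 0 (R - Matrix.vecMulVec w w)).prod (gaussianReal 0 1)) :=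
    hs.comp_snd _
  have h1 : MemLp (fun p : EuclideanSpace ℝ (Fin d) × ℝ => p.1) 2
      ((multivariateGaussian 0 (R - Matrix.vecMulVec w w)).prod (gaussianReal 0 1)) :=
    (memLp_id_multivariateGaussian _ (by simp)).comp_fst _
  have h2w : MemLp (fun p : EuclideanSpace ℝ (Fin d) × ℝ => p.2 • w) 2
      ((multivariateGaussian 0 (R - Matrix.vecMulVec w w)).prod (gaussianReal 0 1)) :=
    (ContinuousLinearMap.toSpanSingleton ℝ w).comp_memLp' h2
  have hint : Integrable
      (fun p : EuclideanSpace ℝ (Fin d) × ℝ => p.2 * fderiv ℝ f (x + (p.1 + p.2 • w)) w)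
      ((multivariateGaussian 0 (R - Matrix.vecMulVec w w)).prod (gaussianReal 0 1)) :=
    h2.integrable_mul (hf.memLp_fderiv_comp ((memLp_const x).add (h1.add h2w)) w)
  refine ⟨hint, ?_⟩
  have hmeas : Measurable fun y => fderiv ℝ (fderiv ℝ f) (x + y) w w :=
    (HasLipschitzFDeriv.measurable_fderiv_fderiv_apply f w w).comp (measurable_const_add x)
  rw [multivariateGaussian_eq_map_add_smul hR, integral_map (by fun_prop)
    hmeas.aestronglyMeasurable,
    integral_prod _ (hf.integrable_fderiv_fderiv_comp (by fun_prop) w w), integral_prod _ hint]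
  congr 1
  ext y
  have hm : MemLp (fun s : ℝ => x + (y + s • w)) 2 (gaussianReal 0 1) :=
    (memLp_const x).add ((memLp_const y).add
      ((ContinuousLinearMap.toSpanSingleton ℝ w).comp_memLp' hs))
  refine integral_deriv_gaussianReal (F := fun s => fderiv ℝ f (x + (y + s • w)) w) (fun s => ?_)
    ((hf.memLp_fderiv_comp hm w).integrable (by norm_num))
    (hf.integrable_fderiv_fderiv_comp (by fun_prop) w w)
    (hs.integrable_mul (hf.memLp_fderiv_comp hm w))
  have hl : HasDerivAt (fun s : ℝ => x + (y + s • w)) w s := by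
    simpa using (((hasDerivAt_id s).smul_const w).const_add y).const_add x
  exact (hf.hasFDerivAt_fderiv_apply w (x + (y + s • w))).comp_hasDerivAt s hl

/-- Gaussian smoothing with covariance at least `r I` makes the second derivative Lipschitz, with
constant `M / √r`. This is the only place where the noise regularizes. -/
theorem abs_integral_fderiv_fderiv_sub_le (hf : HasLipschitzFDeriv f M)
    {R : Matrix (Fin d) (Fin d) ℝ} {r : ℝ} (hr : 0 < r)
    (hR : (R - r • (1 : Matrix (Fin d) (Fin d) ℝ)).PosSemidef) (x z u : EuclideanSpace ℝ (Fin d)) :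
    |∫ y, fderiv ℝ (fderiv ℝ f) (x + y) u u ∂(multivariateGaussian 0 R) -
      ∫ y, fderiv ℝ (fderiv ℝ f) (z + y) u u ∂(multivariateGaussian 0 R)| ≤
      M * ‖x - z‖ * ‖u‖ ^ 2 / √r := by
  rcases eq_or_ne u 0 with rfl | hu
  · simp
  have hu' : 0 < ‖u‖ := norm_pos_iff.2 hu
  have hsr : 0 < √r := Real.sqrt_pos.2 hr
  -- The vector `w = c u` has norm `√r`, the largest for which `r I - w wᵀ` is surely positive
  -- semidefinite; Stein's identity is applied in this direction.
  set c : ℝ := √r / ‖u‖ with hc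
  have hc0 : 0 < c := by positivity
  set w := c • u with hw
  have hnw : ‖w‖ = √r := by
    rw [hw, norm_smul, Real.norm_of_nonneg hc0.le, hc]
    field_simp
  have hRw : (R - Matrix.vecMulVec w w).PosSemidef := by
    have := hR.add (posSemidef_norm_sq_smul_one_sub_vecMulVec w)
    rwa [hnw, Real.sq_sqrt hr.le, sub_add_sub_cancel] at this
  obtain ⟨hi1, he1⟩ := integral_fderiv_fderiv_multivariateGaussian hf hRw x
  obtain ⟨hi2, he2⟩ := integral_fderiv_fderiv_multivariateGaussian hf hRw z
  have hsc : ∀ v, ∫ y, fderiv ℝ (fderiv ℝ f) (v + y) w w ∂(multivariateGaussian 0 R) =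
      c ^ 2 * ∫ y, fderiv ℝ (fderiv ℝ f) (v + y) u u ∂(multivariateGaussian 0 R) := fun v => by
    rw [← integral_const_mul]
    congr 1
    ext y
    simp [hw]
    ring
  have habs : Integrable (fun s : ℝ => |s|) (gaussianReal 0 1) := by
    simpa using (integrable_pow_gaussianReal 1).abs
  have key : |∫ y, fderiv ℝ (fderiv ℝ f) (x + y) w w ∂(multivariateGaussian 0 R) -
      ∫ y, fderiv ℝ (fderiv ℝ f) (z + y) w w ∂(multivariateGaussian 0 R)| ≤ M * ‖x - z‖ * √r := by
    rw [he1, he2, ← integral_sub hi1 hi2, ← Real.norm_eq_abs]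
    calc _ ≤ ∫ p : EuclideanSpace ℝ (Fin d) × ℝ, |p.2| * (M * ‖x - z‖ * √r)
          ∂((multivariateGaussian 0 (R - Matrix.vecMulVec w w)).prod (gaussianReal 0 1)) := by
          refine norm_integral_le_of_norm_le ((habs.comp_snd _).mul_const _)
            (ae_of_all _ fun p => ?_)
          rw [← mul_sub, Real.norm_eq_abs, abs_mul]
          refine mul_le_mul_of_nonneg_left ((hf.abs_fderiv_sub_le _ _ _).trans (le_of_eq ?_))
            (abs_nonneg _)
          rw [hnw, add_sub_add_right_eq_sub]
      _ = (∫ s, |s| ∂(gaussianReal 0 1)) * (M * ‖x - z‖ * √r) := by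
          rw [integral_mul_const, integral_fun_snd (fun s : ℝ => |s|)]
          simp
      _ ≤ 1 * (M * ‖x - z‖ * √r) := by
          gcongr
          exact integral_abs_gaussianReal_le_one
      _ = _ := one_mul _
  rw [hsc, hsc, ← mul_sub, abs_mul, abs_of_nonneg (by positivity)] at key
  rw [le_div_iff₀ hsr]
  have h2 : c ^ 2 * ‖u‖ ^ 2 = √r ^ 2 := by rw [hc]; field_simp
  have h3 := mul_le_mul_of_nonneg_right key (by positivity : 0 ≤ ‖u‖ ^ 2 / √r)
  refine le_trans (le_of_eq ?_) (h3.trans (le_of_eq ?_))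
  · have : c ^ 2 * |∫ y, fderiv ℝ (fderiv ℝ f) (x + y) u u ∂(multivariateGaussian 0 R) -
      ∫ y, fderiv ℝ (fderiv ℝ f) (z + y) u u ∂(multivariateGaussian 0 R)| * (‖u‖ ^ 2 / √r) =
      (c ^ 2 * ‖u‖ ^ 2) * |∫ y, fderiv ℝ (fderiv ℝ f) (x + y) u u ∂(multivariateGaussian 0 R) -
      ∫ y, fderiv ℝ (fderiv ℝ f) (z + y) u u ∂(multivariateGaussian 0 R)| / √r := by ring
    rw [this, h2]
    field_simp
  · field_simp

/-- Second order Taylor expansion of the smoothed function. -/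
theorem abs_integral_add_sub_taylor_two_le (hf : HasLipschitzFDeriv f M)
    {R : Matrix (Fin d) (Fin d) ℝ} {r : ℝ} (hr : 0 < r)
    (hR : (R - r • (1 : Matrix (Fin d) (Fin d) ℝ)).PosSemidef) (x u : EuclideanSpace ℝ (Fin d)) :
    |∫ y, f (x + u + y) ∂(multivariateGaussian 0 R) - ∫ y, f (x + y) ∂(multivariateGaussian 0 R) -
      ∫ y, fderiv ℝ f (x + y) u ∂(multivariateGaussian 0 R) -
      (∫ y, fderiv ℝ (fderiv ℝ f) (x + y) u u ∂(multivariateGaussian 0 R)) / 2| ≤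
      M / (6 * √r) * ‖u‖ ^ 3 := by
  have hid : Integrable id (multivariateGaussian 0 R) :=
    (memLp_id_multivariateGaussian R (p := 1) (by simp)).integrable le_rfl
  have := abs_taylor_two_le
    (φ := fun t : ℝ => ∫ y, f (x + t • u + y) ∂(multivariateGaussian 0 R))
    (φ' := fun t : ℝ => ∫ y, fderiv ℝ f (x + t • u + y) u ∂(multivariateGaussian 0 R))
    (φ'' := fun t : ℝ => ∫ y, fderiv ℝ (fderiv ℝ f) (x + t • u + y) u u ∂(multivariateGaussian 0 R))
    (K := M * ‖u‖ ^ 3 / √r) (fun t => ?_) (fun t => ?_) (fun t ht => ?_)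
  · simp only [one_smul, zero_smul, add_zero] at this
    refine this.trans (le_of_eq ?_)
    field_simp
  · exact hasDerivAt_integral_add_smul hf.differentiable M.2 hf.norm_fderiv_le hid
      (fun x => hf.integrable_comp (memLp_const_add_multivariateGaussian R x (by simp))) x u t
  · have hfd := fun z => (hf.hasFDerivAt_fderiv_apply u z).fderiv
    have := hasDerivAt_integral_add_smul (g := fun z => fderiv ℝ f z u)
      (fun z => (hf.hasFDerivAt_fderiv_apply u z).differentiableAt) (C := M * ‖u‖) le_rfl
      (fun z => ?_) hid
      (fun x => (hf.memLp_fderiv_comp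
        (memLp_const_add_multivariateGaussian R x (p := 1) (by simp)) u).integrable le_rfl) x u t
    · simpa only [hfd, ContinuousLinearMap.flip_apply] using this
    · rw [hfd, zero_mul, add_zero]
      refine ContinuousLinearMap.opNorm_le_bound _ (by positivity) fun v => ?_
      refine (hf.abs_fderiv_fderiv_apply_le z v u).trans (le_of_eq (by ring))
  · refine (abs_integral_fderiv_fderiv_sub_le hf hr hR _ _ u).trans (le_of_eq ?_)
    simp [norm_smul, abs_of_nonneg ht]
    ring

theorem abs_integral_add_sub_taylor_one_le (hf : HasLipschitzFDeriv f M)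
    (R : Matrix (Fin d) (Fin d) ℝ) (x u : EuclideanSpace ℝ (Fin d)) :
    |∫ y, f (x + u + y) ∂(multivariateGaussian 0 R) - ∫ y, f (x + y) ∂(multivariateGaussian 0 R) -
      ∫ y, fderiv ℝ f (x + y) u ∂(multivariateGaussian 0 R)| ≤ M / 2 * ‖u‖ ^ 2 := by
  have h2 : ∀ x : EuclideanSpace ℝ (Fin d),
      Integrable (fun y => f (x + y)) (multivariateGaussian 0 R) := fun x =>
    hf.integrable_comp (memLp_const_add_multivariateGaussian R x (by simp))
  have h1 := (hf.memLp_fderiv_comp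
        (memLp_const_add_multivariateGaussian R x (p := 1) (by simp)) u).integrable le_rfl
  have h21 : Integrable (fun y => f (x + u + y) - f (x + y)) (multivariateGaussian 0 R) :=
    (h2 _).sub (h2 _)
  rw [← integral_sub (h2 _) (h2 _), ← integral_sub h21 h1, ← Real.norm_eq_abs]
  refine (norm_integral_le_of_norm_le (integrable_const (M * ‖u‖ ^ 2 / 2))
    (ae_of_all _ fun y => ?_)).trans (le_of_eq ?_)
  · have := hf.abs_sub_sub_le (x + y) u
    rwa [add_right_comm] at this
  · simp
    ring

end GaussianSmoothing

/-! ### Moments of multivariate Gaussian laws -/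

section Moments

theorem integral_mul_le_sqrt_mul_sqrt {α : Type*} {mα : MeasurableSpace α} {ν : Measure α}
    {g h : α → ℝ} (hg : 0 ≤ g) (hh : 0 ≤ h) (hg2 : MemLp g 2 ν) (hh2 : MemLp h 2 ν) :
    ∫ a, g a * h a ∂ν ≤ √(∫ a, g a ^ 2 ∂ν) * √(∫ a, h a ^ 2 ∂ν) := by
  have := integral_mul_le_Lp_mul_Lq_of_nonneg Real.HolderConjugate.two_two
    (ae_of_all ν hg) (ae_of_all ν hh) (by simpa using hg2) (by simpa using hh2)
  simpa [Real.sqrt_eq_rpow] using this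

variable {d : ℕ} {V : Matrix (Fin d) (Fin d) ℝ}

theorem memLp_apply_multivariateGaussian (V : Matrix (Fin d) (Fin d) ℝ) (i : Fin d) {p : ℝ≥0∞}
    (hp : p ≠ ∞) :
    MemLp (fun w : EuclideanSpace ℝ (Fin d) => w i) p (multivariateGaussian 0 V) :=
  (EuclideanSpace.proj (𝕜 := ℝ) i).comp_memLp' (memLp_id_multivariateGaussian V hp)

theorem integral_apply_multivariateGaussian (V : Matrix (Fin d) (Fin d) ℝ) (i : Fin d) :
    ∫ w, w i ∂(multivariateGaussian 0 V) = 0 := by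
  have := (EuclideanSpace.proj (𝕜 := ℝ) i).integral_comp_comm (μ := multivariateGaussian 0 V)
    ((memLp_id_multivariateGaussian V (p := 1) (by simp)).integrable le_rfl)
  simpa using this

theorem integrable_apply_mul_apply_multivariateGaussian (V : Matrix (Fin d) (Fin d) ℝ)
    (i j : Fin d) : Integrable (fun w : EuclideanSpace ℝ (Fin d) => w i * w j)
      (multivariateGaussian 0 V) :=
  (memLp_apply_multivariateGaussian V i (p := 2) (by simp)).integrable_mul
    (memLp_apply_multivariateGaussian V j (p := 2) (by simp))

theorem integral_apply_mul_apply_multivariateGaussian (hV : V.PosSemidef) (i j : Fin d) :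
    ∫ w, w i * w j ∂(multivariateGaussian 0 V) = V i j := by
  rw [← covariance_eval_multivariateGaussian (μ := 0) hV i j,
    covariance_eq_sub (memLp_apply_multivariateGaussian V i (by simp))
      (memLp_apply_multivariateGaussian V j (by simp))]
  simp [integral_apply_multivariateGaussian]

theorem integral_apply_pow_four_multivariateGaussian (hV : V.PosSemidef) (i : Fin d) :
    ∫ w, w i ^ 4 ∂(multivariateGaussian 0 V) = 3 * V i i ^ 2 := by
  have hii : 0 ≤ V i i := hV.diag_nonneg
  have h := measurePreserving_eval_multivariateGaussian (μ := 0) hV (i := i)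
  have h1 : gaussianReal ((0 : EuclideanSpace ℝ (Fin d)) i) (V i i).toNNReal =
      (gaussianReal 0 1).map (fun s => √(V i i) * s) := by
    rw [gaussianReal_map_const_mul]
    congr 1
    · simp
    · ext
      simp [Real.coe_toNNReal _ hii, Real.sq_sqrt hii]
  have h2 := integral_map (μ := multivariateGaussian 0 V) h.measurable.aemeasurable
    (f := fun s : ℝ => s ^ 4) (by fun_prop)
  rw [← h2, h.map_eq, h1, integral_map (by fun_prop) (by fun_prop)]
  simp_rw [mul_pow]
  rw [integral_const_mul, integral_pow_four_gaussianReal,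
    show √(V i i) ^ 4 = (√(V i i) ^ 2) ^ 2 by ring, Real.sq_sqrt hii]
  ring

theorem integral_norm_sq_multivariateGaussian (hV : V.PosSemidef) :
    ∫ w, ‖w‖ ^ 2 ∂(multivariateGaussian 0 V) = V.trace := by
  simp_rw [EuclideanSpace.real_norm_sq_eq, pow_two]
  rw [integral_finsetSum _ fun i _ => integrable_apply_mul_apply_multivariateGaussian V i i]
  simp [integral_apply_mul_apply_multivariateGaussian hV, Matrix.trace]

theorem memLp_apply_sq_multivariateGaussian (V : Matrix (Fin d) (Fin d) ℝ) (i : Fin d) :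
    MemLp (fun w : EuclideanSpace ℝ (Fin d) => w i ^ 2) 2 (multivariateGaussian 0 V) := by
  rw [memLp_two_iff_integrable_sq (by fun_prop)]
  refine ((memLp_apply_multivariateGaussian V i (p := 4) (by simp)).integrable_norm_pow').congr
    (ae_of_all _ fun w => ?_)
  simp only [Real.norm_eq_abs, ← pow_mul]
  exact Even.pow_abs (by decide) _

theorem memLp_norm_sq_multivariateGaussian (V : Matrix (Fin d) (Fin d) ℝ) :
    MemLp (fun w : EuclideanSpace ℝ (Fin d) => ‖w‖ ^ 2) 2 (multivariateGaussian 0 V) := by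
  simp_rw [EuclideanSpace.real_norm_sq_eq]
  exact memLp_finsetSum _ fun i _ => memLp_apply_sq_multivariateGaussian V i

theorem integral_norm_pow_four_multivariateGaussian_le (hV : V.PosSemidef) :
    ∫ w, (‖w‖ ^ 2) ^ 2 ∂(multivariateGaussian 0 V) ≤ 3 * V.trace ^ 2 := by
  have hint : ∀ i j, Integrable (fun w : EuclideanSpace ℝ (Fin d) => w i ^ 2 * w j ^ 2)
      (multivariateGaussian 0 V) := fun i j =>
    (memLp_apply_sq_multivariateGaussian V i).integrable_mul
      (memLp_apply_sq_multivariateGaussian V j)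
  have hle : ∀ i j, ∫ w, w i ^ 2 * w j ^ 2 ∂(multivariateGaussian 0 V) ≤ 3 * (V i i * V j j) := by
    intro i j
    have hii : 0 ≤ V i i := hV.diag_nonneg
    have hjj : 0 ≤ V j j := hV.diag_nonneg
    refine (integral_mul_le_sqrt_mul_sqrt (fun w => sq_nonneg _) (fun w => sq_nonneg _)
      (memLp_apply_sq_multivariateGaussian V i) (memLp_apply_sq_multivariateGaussian V j)).trans ?_
    simp_rw [← pow_mul]
    norm_num only [integral_apply_pow_four_multivariateGaussian hV]
    rw [← Real.sqrt_mul (by positivity),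
      show 3 * V i i ^ 2 * (3 * V j j ^ 2) = (3 * (V i i * V j j)) ^ 2 by ring,
      Real.sqrt_sq (by positivity)]
  simp_rw [EuclideanSpace.real_norm_sq_eq, pow_two (Finset.sum _ _), Finset.sum_mul_sum]
  rw [integral_finsetSum _ fun i _ => integrable_finsetSum _ fun j _ => hint i j]
  simp_rw [integral_finsetSum _ fun j _ => hint _ j]
  rw [Matrix.trace, pow_two, Finset.sum_mul_sum, Finset.mul_sum]
  refine Finset.sum_le_sum fun i _ => ?_
  rw [Finset.mul_sum]
  exact Finset.sum_le_sum fun j _ => hle i j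

theorem integrable_norm_pow_multivariateGaussian (V : Matrix (Fin d) (Fin d) ℝ) (k : ℕ) :
    Integrable (fun w : EuclideanSpace ℝ (Fin d) => ‖w‖ ^ k) (multivariateGaussian 0 V) :=
  (memLp_id_multivariateGaussian V (p := k) (by simp)).integrable_norm_pow'

theorem integral_norm_pow_three_multivariateGaussian_le (hV : V.PosSemidef) :
    ∫ w, ‖w‖ ^ 3 ∂(multivariateGaussian 0 V) ≤ √3 * √V.trace ^ 3 := by
  have htr : 0 ≤ V.trace := hV.trace_nonneg
  calc ∫ w, ‖w‖ ^ 3 ∂(multivariateGaussian 0 V)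
      = ∫ w, ‖w‖ * ‖w‖ ^ 2 ∂(multivariateGaussian 0 V) := by simp_rw [← pow_succ']
    _ ≤ √V.trace * √(3 * V.trace ^ 2) := by
        refine (integral_mul_le_sqrt_mul_sqrt (fun w => norm_nonneg w) (fun w => sq_nonneg _)
          (memLp_id_multivariateGaussian V (by simp)).norm
          (memLp_norm_sq_multivariateGaussian V)).trans ?_
        rw [integral_norm_sq_multivariateGaussian hV]
        gcongr
        exact integral_norm_pow_four_multivariateGaussian_le hV
    _ = √3 * √V.trace ^ 3 := by
        rw [Real.sqrt_mul (by norm_num), Real.sqrt_sq htr]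
        nth_rewrite 2 [← Real.sq_sqrt htr]
        ring

end Moments

/-! ### Replacing one increment by a Gaussian one -/

section OneStep

variable {d : ℕ} {f : EuclideanSpace ℝ (Fin d) → ℝ} {M : NNReal}

/-- The average of `F` over the Gaussian law with mean `x` and covariance `R`. -/
noncomputable def gaussianAverage (F : EuclideanSpace ℝ (Fin d) → ℝ)
    (R : Matrix (Fin d) (Fin d) ℝ) (x : EuclideanSpace ℝ (Fin d)) : ℝ :=
  ∫ y, F (x + y) ∂(multivariateGaussian 0 R)

/-- The `i`-th partial derivative of `f`. -/
noncomputable def partialDeriv (f : EuclideanSpace ℝ (Fin d) → ℝ) (i : Fin d)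
    (x : EuclideanSpace ℝ (Fin d)) : ℝ :=
  fderiv ℝ f x (EuclideanSpace.single i 1)

/-- The second partial derivative of `f` in the directions `i` and `j`. -/
noncomputable def partialDeriv₂ (f : EuclideanSpace ℝ (Fin d) → ℝ) (i j : Fin d)
    (x : EuclideanSpace ℝ (Fin d)) : ℝ :=
  fderiv ℝ (fderiv ℝ f) x (EuclideanSpace.single i 1) (EuclideanSpace.single j 1)

theorem eq_sum_smul_single (u : EuclideanSpace ℝ (Fin d)) :
    u = ∑ i, u i • EuclideanSpace.single i (1 : ℝ) := by
  ext j
  simp [Finset.sum_apply, Pi.single_apply]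

theorem integral_fderiv_eq_sum (hf : HasLipschitzFDeriv f M) (R : Matrix (Fin d) (Fin d) ℝ)
    (x u : EuclideanSpace ℝ (Fin d)) :
    ∫ y, fderiv ℝ f (x + y) u ∂(multivariateGaussian 0 R) =
      ∑ i, u i * gaussianAverage (partialDeriv f i) R x := by
  have h : ∀ z, fderiv ℝ f z u = ∑ i, u i * partialDeriv f i z := fun z => by
    conv_lhs => rw [eq_sum_smul_single u]
    simp [partialDeriv]
  simp_rw [h, gaussianAverage, ← integral_const_mul]
  refine integral_finsetSum _ fun i _ => Integrable.const_mul ?_ _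
  exact (hf.memLp_fderiv_comp (memLp_const_add_multivariateGaussian R x (p := 1) (by simp))
    _).integrable le_rfl

theorem integral_fderiv_fderiv_eq_sum (hf : HasLipschitzFDeriv f M) (R : Matrix (Fin d) (Fin d) ℝ)
    (x u : EuclideanSpace ℝ (Fin d)) :
    ∫ y, fderiv ℝ (fderiv ℝ f) (x + y) u u ∂(multivariateGaussian 0 R) =
      ∑ i, ∑ j, u i * u j * gaussianAverage (partialDeriv₂ f i j) R x := by
  have h : ∀ z, fderiv ℝ (fderiv ℝ f) z u u = ∑ i, ∑ j, u i * u j * partialDeriv₂ f i j z :=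
    fun z => by
      conv_lhs => rw [eq_sum_smul_single u]
      simp only [map_sum, map_smul, _root_.sum_apply, _root_.smul_apply, smul_eq_mul,
        Finset.mul_sum, partialDeriv₂, mul_assoc]
      rw [Finset.sum_comm]
      exact Finset.sum_congr rfl fun i _ => Finset.sum_congr rfl fun j _ => by ring
  have hint : ∀ i j, Integrable (fun y => u i * u j * partialDeriv₂ f i j (x + y))
      (multivariateGaussian 0 R) := fun i j =>
    (hf.integrable_fderiv_fderiv_comp (by fun_prop) _ _).const_mul _
  simp_rw [h, gaussianAverage, ← integral_const_mul]
  rw [integral_finsetSum _ fun i _ => integrable_finsetSum _ fun j _ => hint i j]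
  exact Finset.sum_congr rfl fun i _ => integral_finsetSum _ fun j _ => hint i j

theorem integrable_gaussianAverage_and_integral_eq (hf : HasLipschitzFDeriv f M)
    {R V : Matrix (Fin d) (Fin d) ℝ} (hR : R.PosSemidef) (hV : V.PosSemidef)
    (x : EuclideanSpace ℝ (Fin d)) :
    Integrable (fun w => gaussianAverage f R (x + w)) (multivariateGaussian 0 V) ∧
    ∫ w, gaussianAverage f R (x + w) ∂(multivariateGaussian 0 V) =
      gaussianAverage f (R + V) x := by
  have hint : Integrable (fun p : EuclideanSpace ℝ (Fin d) × EuclideanSpace ℝ (Fin d) =>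
      f (x + (p.1 + p.2))) ((multivariateGaussian 0 V).prod (multivariateGaussian 0 R)) := by
    refine hf.integrable_comp ((memLp_const x).add (MemLp.add ?_ ?_))
    · exact (memLp_id_multivariateGaussian V (by simp)).comp_fst _
    · exact (memLp_id_multivariateGaussian R (by simp)).comp_snd _
  have hcont := hf.differentiable.continuous
  have hcont' : Continuous fun y => f (x + y) := by fun_prop
  constructor
  · simpa only [gaussianAverage, add_assoc] using hint.integral_prod_left
  · rw [add_comm R V, gaussianAverage, multivariateGaussian_zero_add hV hR,
      integral_map (by fun_prop) hcont'.aestronglyMeasurable, integral_prod _ hint]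
    simp only [gaussianAverage, add_assoc]

/-- Replacing an increment `u` by a Gaussian one with covariance `V`, under the smoothing of a
Gaussian with covariance at least `r I`: apart from the linear term and the quadratic term in
`u uᵀ - V`, only a cubic error remains. -/
theorem abs_gaussianAverage_sub_le (hf : HasLipschitzFDeriv f M)
    {R V : Matrix (Fin d) (Fin d) ℝ} {r : ℝ} (hr : 0 < r) (hR : R.PosSemidef)
    (hRr : (R - r • (1 : Matrix (Fin d) (Fin d) ℝ)).PosSemidef) (hV : V.PosSemidef)
    (x u : EuclideanSpace ℝ (Fin d)) :
    |gaussianAverage f R (x + u) - gaussianAverage f (R + V) x -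
      ∑ i, u i * gaussianAverage (partialDeriv f i) R x -
      (∑ i, ∑ j, (u i * u j - V i j) * gaussianAverage (partialDeriv₂ f i j) R x) / 2| ≤
      M / (6 * √r) * (‖u‖ ^ 3 + √3 * √V.trace ^ 3) := by
  have key : ∀ w, |gaussianAverage f R (x + w) - gaussianAverage f R x -
      ∑ i, w i * gaussianAverage (partialDeriv f i) R x -
      (∑ i, ∑ j, w i * w j * gaussianAverage (partialDeriv₂ f i j) R x) / 2| ≤
      M / (6 * √r) * ‖w‖ ^ 3 := fun w => by
    have := abs_integral_add_sub_taylor_two_le hf hr hRr x w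
    rwa [integral_fderiv_eq_sum hf, integral_fderiv_fderiv_eq_sum hf] at this
  obtain ⟨hi, he⟩ := integrable_gaussianAverage_and_integral_eq hf hR hV x
  have h1 : Integrable (fun w : EuclideanSpace ℝ (Fin d) =>
      ∑ i, w i * gaussianAverage (partialDeriv f i) R x) (multivariateGaussian 0 V) :=
    integrable_finsetSum _ fun i _ =>
      ((memLp_apply_multivariateGaussian V i (p := 1) (by simp)).integrable le_rfl).mul_const _
  have h2' : ∀ i j, Integrable (fun w : EuclideanSpace ℝ (Fin d) =>
      w i * w j * gaussianAverage (partialDeriv₂ f i j) R x) (multivariateGaussian 0 V) :=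
    fun i j => (integrable_apply_mul_apply_multivariateGaussian V i j).mul_const _
  have h2 : Integrable (fun w : EuclideanSpace ℝ (Fin d) =>
      ∑ i, ∑ j, w i * w j * gaussianAverage (partialDeriv₂ f i j) R x)
      (multivariateGaussian 0 V) :=
    integrable_finsetSum _ fun i _ => integrable_finsetSum _ fun j _ => h2' i j
  have e1 : ∫ w, ∑ i, w i * gaussianAverage (partialDeriv f i) R x
      ∂(multivariateGaussian 0 V) = 0 := by
    rw [integral_finsetSum _ fun i _ => ((memLp_apply_multivariateGaussian V i (p := 1)
      (by simp)).integrable le_rfl).mul_const _]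
    simp [integral_mul_const, integral_apply_multivariateGaussian]
  have e2 : ∫ w, ∑ i, ∑ j, w i * w j * gaussianAverage (partialDeriv₂ f i j) R x
      ∂(multivariateGaussian 0 V) =
      ∑ i, ∑ j, V i j * gaussianAverage (partialDeriv₂ f i j) R x := by
    rw [integral_finsetSum _ fun i _ => integrable_finsetSum _ fun j _ => h2' i j]
    refine Finset.sum_congr rfl fun i _ => ?_
    rw [integral_finsetSum _ fun j _ => h2' i j]
    simp [integral_mul_const, integral_apply_mul_apply_multivariateGaussian hV]
  have hG : |gaussianAverage f (R + V) x - gaussianAverage f R x -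
      (∑ i, ∑ j, V i j * gaussianAverage (partialDeriv₂ f i j) R x) / 2| ≤
      M / (6 * √r) * (√3 * √V.trace ^ 3) := by
    have := norm_integral_le_of_norm_le (μ := multivariateGaussian 0 V)
      ((integrable_norm_pow_multivariateGaussian V 3).const_mul (M / (6 * √r)))
      (ae_of_all _ fun w => (Real.norm_eq_abs _).trans_le (key w))
    have hi0 : Integrable (fun w => gaussianAverage f R (x + w) - gaussianAverage f R x)
        (multivariateGaussian 0 V) := hi.sub (integrable_const _)
    have hi1 : Integrable (fun w => gaussianAverage f R (x + w) - gaussianAverage f R x -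
        ∑ i, w i * gaussianAverage (partialDeriv f i) R x) (multivariateGaussian 0 V) :=
      hi0.sub h1
    rw [integral_sub hi1 (h2.div_const 2), integral_sub hi0 h1, integral_sub hi (integrable_const _),
      integral_div, e1, e2, he, integral_const_mul] at this
    simp only [integral_const, probReal_univ, one_smul, sub_zero, Real.norm_eq_abs] at this
    refine this.trans ?_
    gcongr
    exact integral_norm_pow_three_multivariateGaussian_le hV
  have := (abs_sub _ _).trans (add_le_add (key u) hG)
  rw [← mul_add] at this
  refine le_trans (le_of_eq (congrArg _ ?_)) this
  simp only [sub_mul, Finset.sum_sub_distrib]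
  ring

/-- The variant of `abs_gaussianAverage_sub_le` in which no smoothing is available. -/
theorem abs_gaussianAverage_sub_le' (hf : HasLipschitzFDeriv f M)
    {R V : Matrix (Fin d) (Fin d) ℝ} (hR : R.PosSemidef) (hV : V.PosSemidef)
    (x u : EuclideanSpace ℝ (Fin d)) :
    |gaussianAverage f R (x + u) - gaussianAverage f (R + V) x -
      ∑ i, u i * gaussianAverage (partialDeriv f i) R x| ≤ M / 2 * (‖u‖ ^ 2 + V.trace) := by
  have key : ∀ w, |gaussianAverage f R (x + w) - gaussianAverage f R x -
      ∑ i, w i * gaussianAverage (partialDeriv f i) R x| ≤ M / 2 * ‖w‖ ^ 2 := fun w => by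
    have := abs_integral_add_sub_taylor_one_le hf R x w
    rwa [integral_fderiv_eq_sum hf] at this
  obtain ⟨hi, he⟩ := integrable_gaussianAverage_and_integral_eq hf hR hV x
  have h1' : ∀ i, Integrable (fun w : EuclideanSpace ℝ (Fin d) =>
      w i * gaussianAverage (partialDeriv f i) R x) (multivariateGaussian 0 V) := fun i =>
    ((memLp_apply_multivariateGaussian V i (p := 1) (by simp)).integrable le_rfl).mul_const _
  have e1 : ∫ w, ∑ i, w i * gaussianAverage (partialDeriv f i) R x
      ∂(multivariateGaussian 0 V) = 0 := by
    rw [integral_finsetSum _ fun i _ => h1' i]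
    simp [integral_mul_const, integral_apply_multivariateGaussian]
  have hG : |gaussianAverage f (R + V) x - gaussianAverage f R x| ≤ M / 2 * V.trace := by
    have := norm_integral_le_of_norm_le (μ := multivariateGaussian 0 V)
      ((integrable_norm_pow_multivariateGaussian V 2).const_mul (M / 2 : ℝ)) 
      (ae_of_all _ fun w => (Real.norm_eq_abs _).trans_le (key w))
    have hi0 : Integrable (fun w => gaussianAverage f R (x + w) - gaussianAverage f R x)
        (multivariateGaussian 0 V) := hi.sub (integrable_const _)
    rw [integral_sub hi0 (integrable_finsetSum _ fun i _ => h1' i),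
      integral_sub hi (integrable_const _), e1, he, integral_const_mul,
      integral_norm_sq_multivariateGaussian hV] at this
    simpa only [integral_const, probReal_univ, one_smul, sub_zero, Real.norm_eq_abs] using this
  have := (abs_sub _ _).trans (add_le_add (key u) hG)
  rw [← mul_add] at this
  refine le_trans (le_of_eq (congrArg _ ?_)) this
  ring

end OneStep

/-! ### Measurable dependence of Gaussian averages on mean and covariance -/

section Measurability

variable {d : ℕ}

open scoped Matrix.Norms.L2Operator in
theorem continuousOn_matrix_sqrt :
    ContinuousOn (fun A : Matrix (Fin d) (Fin d) ℝ => CFC.sqrt A) {A | 0 ≤ A} :=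
  CFC.continuousOn_sqrt

theorem isClosed_setOf_posSemidef :
    IsClosed {A : Matrix (Fin d) (Fin d) ℝ | A.PosSemidef} := by
  simp only [Matrix.posSemidef_iff_dotProduct_mulVec, Set.ofPred_and, Set.ofPred_forall]
  refine (isClosed_eq (by fun_prop) continuous_id).inter (isClosed_iInter fun x => ?_)
  exact isClosed_le continuous_const (by fun_prop)

theorem measurable_sqrt_apply (i j : Fin d) :
    Measurable (fun A : Fin d → Fin d → ℝ => CFC.sqrt (Matrix.of A) i j) := by
  have h : ContinuousOn (fun A : Fin d → Fin d → ℝ => CFC.sqrt (Matrix.of A) i j)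
      {A | (Matrix.of A).PosSemidef} :=
    ((continuous_apply_apply i j).comp_continuousOn continuousOn_matrix_sqrt).mono
      fun A hA => Matrix.PosSemidef.nonneg hA
  have hc : IsClosed {A : Fin d → Fin d → ℝ | (Matrix.of A).PosSemidef} :=
    isClosed_setOf_posSemidef
  have hs := hc.measurableSet
  classical
  have := h.measurable_piecewise (g := fun _ => (0 : ℝ)) continuousOn_const hs
  convert this using 1
  ext A
  by_cases hA : (Matrix.of A).PosSemidef
  · simp [Set.piecewise, hA]
  -- `CFC.sqrt` is zero on matrices that are not positive semidefinite.
  · have : CFC.sqrt (Matrix.of A) = 0 := by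
      rw [CFC.sqrt, cfcₙ_apply_of_not_predicate]
      change ¬ (Matrix.of A - 0).PosSemidef
      simpa
    simp [Set.piecewise, hA, this]

theorem stronglyMeasurable_gaussianAverage_comp {Ω : Type*} {m : MeasurableSpace Ω}
    {F : EuclideanSpace ℝ (Fin d) → ℝ} (hF : Measurable F)
    {Q : Ω → Matrix (Fin d) (Fin d) ℝ} (hQ : ∀ i j, Measurable fun ω => Q ω i j)
    {S : Ω → EuclideanSpace ℝ (Fin d)} (hS : Measurable S) :
    StronglyMeasurable fun ω => gaussianAverage F (Q ω) (S ω) := by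
  have h1 : ∀ i j, Measurable fun ω => CFC.sqrt (Q ω) i j := fun i j =>
    (measurable_sqrt_apply i j).comp (measurable_pi_lambda _ fun i => measurable_pi_lambda _ (hQ i))
  have h2 : Measurable fun p : Ω × EuclideanSpace ℝ (Fin d) =>
      Matrix.toEuclideanCLM (𝕜 := ℝ) (CFC.sqrt (Q p.1)) p.2 := by
    have : Measurable fun p : Ω × EuclideanSpace ℝ (Fin d) =>
        (fun i => ∑ j, CFC.sqrt (Q p.1) i j * p.2 j : Fin d → ℝ) := by
      refine measurable_pi_lambda _ fun i => Finset.measurable_sum _ fun j _ => ?_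
      exact ((h1 i j).comp measurable_fst).mul (by fun_prop)
    exact (WithLp.measurable_toLp 2 _).comp this
  have h3 : ∀ ω, gaussianAverage F (Q ω) (S ω) =
      ∫ z, F (S ω + Matrix.toEuclideanCLM (𝕜 := ℝ) (CFC.sqrt (Q ω)) z)
        ∂(stdGaussian (EuclideanSpace ℝ (Fin d))) := fun ω => by
    have hF' : Measurable fun y => F (S ω + y) := hF.comp (measurable_const_add _)
    rw [gaussianAverage, multivariateGaussian, integral_map (by fun_prop)
      hF'.aestronglyMeasurable]
    simp
  simp_rw [h3]
  have h4 : StronglyMeasurable fun p : Ω × EuclideanSpace ℝ (Fin d) =>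
      F (S p.1 + Matrix.toEuclideanCLM (𝕜 := ℝ) (CFC.sqrt (Q p.1)) p.2) :=
    (hF.comp ((hS.comp measurable_fst).add h2)).stronglyMeasurable
  exact h4.integral_prod_right

end Measurability

/-! ### Growth of Gaussian averages -/

section Bounds

variable {d : ℕ} {f : EuclideanSpace ℝ (Fin d) → ℝ} {M : NNReal}
  {R : Matrix (Fin d) (Fin d) ℝ}

theorem gaussianAverage_zero (F : EuclideanSpace ℝ (Fin d) → ℝ) (x : EuclideanSpace ℝ (Fin d)) :
    gaussianAverage F 0 x = F x := by
  simp [gaussianAverage, multivariateGaussian]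

theorem abs_gaussianAverage_sub_self_le (hf : HasLipschitzFDeriv f M) (hR : R.PosSemidef)
    (x : EuclideanSpace ℝ (Fin d)) : |gaussianAverage f R x - f x| ≤ M / 2 * R.trace := by
  have := abs_gaussianAverage_sub_le' hf Matrix.PosSemidef.zero hR x 0
  simpa [gaussianAverage_zero, abs_sub_comm] using this

theorem measurable_partialDeriv (f : EuclideanSpace ℝ (Fin d) → ℝ) (i : Fin d) :
    Measurable (partialDeriv f i) :=
  HasLipschitzFDeriv.measurable_fderiv_apply f _

theorem measurable_partialDeriv₂ (f : EuclideanSpace ℝ (Fin d) → ℝ) (i j : Fin d) :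
    Measurable (partialDeriv₂ f i j) :=
  HasLipschitzFDeriv.measurable_fderiv_fderiv_apply f _ _

theorem abs_gaussianAverage_partialDeriv_le (hf : HasLipschitzFDeriv f M) (hR : R.PosSemidef)
    (i : Fin d) (x : EuclideanSpace ℝ (Fin d)) :
    |gaussianAverage (partialDeriv f i) R x| ≤ ‖fderiv ℝ f 0‖ + M * (‖x‖ + (1 + R.trace)) := by
  have h2 := integrable_norm_pow_multivariateGaussian R 2
  have hpt : ∀ y, ‖partialDeriv f i (x + y)‖ ≤
      ‖fderiv ℝ f 0‖ + M * (‖x‖ + (1 + ‖y‖ ^ 2)) := fun y => by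
    refine ((fderiv ℝ f (x + y)).le_opNorm _).trans ?_
    rw [PiLp.norm_single, norm_one, mul_one]
    refine (hf.norm_fderiv_le _).trans ?_
    gcongr
    refine (norm_add_le _ _).trans ?_
    gcongr
    nlinarith [sq_nonneg (‖y‖ - 1), norm_nonneg y]
  have i1 : Integrable (fun y : EuclideanSpace ℝ (Fin d) => 1 + ‖y‖ ^ 2)
      (multivariateGaussian 0 R) := (integrable_const _).add h2
  have i2 : Integrable (fun y : EuclideanSpace ℝ (Fin d) => ‖x‖ + (1 + ‖y‖ ^ 2))
      (multivariateGaussian 0 R) := (integrable_const _).add i1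
  have i3 : Integrable (fun y : EuclideanSpace ℝ (Fin d) =>
      ‖fderiv ℝ f 0‖ + M * (‖x‖ + (1 + ‖y‖ ^ 2))) (multivariateGaussian 0 R) :=
    (integrable_const _).add (i2.const_mul _)
  refine (norm_integral_le_of_norm_le i3 (ae_of_all _ hpt)).trans (le_of_eq ?_)
  rw [integral_add (integrable_const _) (i2.const_mul _), integral_const_mul,
    integral_add (integrable_const _) i1, integral_add (integrable_const _) h2,
    integral_norm_sq_multivariateGaussian hR]
  simp

theorem abs_gaussianAverage_partialDeriv₂_le (hf : HasLipschitzFDeriv f M)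
    (R : Matrix (Fin d) (Fin d) ℝ) (i j : Fin d) (x : EuclideanSpace ℝ (Fin d)) :
    |gaussianAverage (partialDeriv₂ f i j) R x| ≤ M := by
  have := norm_integral_le_of_norm_le_const (μ := multivariateGaussian 0 R)
    (f := fun y => partialDeriv₂ f i j (x + y)) (C := M) (ae_of_all _ fun y => ?_)
  · simpa [gaussianAverage] using this
  simpa [partialDeriv₂] using hf.abs_fderiv_fderiv_apply_le (x + y) (EuclideanSpace.single i 1)
    (EuclideanSpace.single j 1)

end Bounds

/-! ### One step of the martingale -/

section Probability

variable {Ω : Type*} {m mΩ : MeasurableSpace Ω} {P : Measure Ω}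
  {d : ℕ} {f : EuclideanSpace ℝ (Fin d) → ℝ} {M : NNReal}

theorem integral_mul_condExp [IsProbabilityMeasure P] (hm : m ≤ mΩ) {a g : Ω → ℝ}
    (ha : StronglyMeasurable[m] a) (hag : Integrable (fun ω => a ω * g ω) P) (hg : Integrable g P) :
    ∫ ω, a ω * (P[g | m]) ω ∂P = ∫ ω, a ω * g ω ∂P := by
  rw [← integral_condExp hm (f := fun ω => a ω * g ω)]
  exact integral_congr_ae (condExp_mul_of_stronglyMeasurable_left ha hag hg).symm

theorem integrable_gaussianAverage [IsProbabilityMeasure P] (hf : HasLipschitzFDeriv f M)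
    {Q : Ω → Matrix (Fin d) (Fin d) ℝ} (hQ : ∀ i j, Measurable fun ω => Q ω i j)
    (hQ' : ∀ᵐ ω ∂P, (Q ω).PosSemidef) {C : ℝ} (hC : ∀ᵐ ω ∂P, (Q ω).trace ≤ C)
    {S : Ω → EuclideanSpace ℝ (Fin d)} (hS : Measurable S) (hS' : MemLp S 2 P) :
    Integrable (fun ω => gaussianAverage f (Q ω) (S ω)) P := by
  refine Integrable.mono' ((hf.integrable_comp hS').abs.add (integrable_const (M / 2 * C)))
    (stronglyMeasurable_gaussianAverage_comp hf.differentiable.continuous.measurable hQ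
      hS).aestronglyMeasurable
    ?_
  filter_upwards [hQ', hC] with ω h1 h2
  have h3 := abs_gaussianAverage_sub_self_le hf h1 (S ω)
  have h4 := abs_sub_abs_le_abs_sub (gaussianAverage f (Q ω) (S ω)) (f (S ω))
  have h5 : (M : ℝ) / 2 * (Q ω).trace ≤ M / 2 * C := by gcongr
  rw [Real.norm_eq_abs, Pi.add_apply]
  linarith

/-- One step of a martingale, seen from its past `m`: a start `S`, an increment `X` that is
centred given `m` and has conditional covariance `V`, and the covariance `Q`, known given `m`, of
the Gaussian that replaces the increments still to come. The bound `C` on the trace makes all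
averages over Gaussians with covariance `Q` or `Q + V` integrable. -/
structure IsMartingaleStep (P : Measure Ω) (m : MeasurableSpace Ω)
    (S X : Ω → EuclideanSpace ℝ (Fin d)) (V Q : Ω → Matrix (Fin d) (Fin d) ℝ) (C : ℝ) : Prop where
  le : m ≤ mΩ
  memLp_increment : MemLp X 3 P
  measurable_increment : Measurable[mΩ] X
  condExp_increment : P[X | m] =ᵐ[P] 0
  condCov_eq : ∀ i j, (fun ω => V ω i j) = P[fun ω => X ω i * X ω j | m]
  measurable_start : Measurable[m] S
  memLp_start : MemLp S 2 P
  measurable_rest : ∀ i j, Measurable[m] fun ω => Q ω i j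
  posSemidef_rest : ∀ᵐ ω ∂P, (Q ω).PosSemidef
  posSemidef_condCov : ∀ᵐ ω ∂P, (V ω).PosSemidef
  trace_le : ∀ᵐ ω ∂P, (Q ω + V ω).trace ≤ C

namespace IsMartingaleStep

variable {S X : Ω → EuclideanSpace ℝ (Fin d)} {V Q : Ω → Matrix (Fin d) (Fin d) ℝ} {C : ℝ}

theorem stronglyMeasurable_condCov (h : IsMartingaleStep P m S X V Q C) (i j : Fin d) :
    StronglyMeasurable[m] fun ω => V ω i j := by
  rw [h.condCov_eq]
  exact stronglyMeasurable_condExp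

theorem trace_condCov_le (h : IsMartingaleStep P m S X V Q C) : ∀ᵐ ω ∂P, (V ω).trace ≤ C := by
  filter_upwards [h.trace_le, h.posSemidef_rest] with ω h1 h2
  rw [Matrix.trace_add] at h1
  linarith [h2.trace_nonneg]

theorem trace_rest_le (h : IsMartingaleStep P m S X V Q C) : ∀ᵐ ω ∂P, (Q ω).trace ≤ C := by
  filter_upwards [h.trace_le, h.posSemidef_condCov] with ω h1 h2
  rw [Matrix.trace_add] at h1
  linarith [h2.trace_nonneg]

theorem memLp_apply (h : IsMartingaleStep P m S X V Q C) (i : Fin d) :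
    MemLp (fun ω => X ω i) 3 P :=
  (EuclideanSpace.proj (𝕜 := ℝ) i).comp_memLp' h.memLp_increment

theorem stronglyMeasurable_gaussianAverage (h : IsMartingaleStep P m S X V Q C)
    {F : EuclideanSpace ℝ (Fin d) → ℝ} (hF : Measurable F) :
    StronglyMeasurable[m] fun ω => gaussianAverage F (Q ω) (S ω) :=
  stronglyMeasurable_gaussianAverage_comp hF h.measurable_rest h.measurable_start

theorem stronglyMeasurable_sqrt_trace (h : IsMartingaleStep P m S X V Q C) :
    StronglyMeasurable[m] fun ω => √(V ω).trace := by
  refine (Measurable.sqrt ?_).stronglyMeasurable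
  exact Finset.measurable_sum _ fun i _ => (h.stronglyMeasurable_condCov i i).measurable

theorem abs_sqrt_trace_le (h : IsMartingaleStep P m S X V Q C) :
    ∀ᵐ ω ∂P, ‖√(V ω).trace‖ ≤ √C := by
  filter_upwards [h.trace_condCov_le] with ω h1
  rw [Real.norm_of_nonneg (Real.sqrt_nonneg _)]
  exact Real.sqrt_le_sqrt h1

variable [IsProbabilityMeasure P]

theorem integrable_apply_mul_apply (h : IsMartingaleStep P m S X V Q C) (i j : Fin d) :
    Integrable (fun ω => X ω i * X ω j) P :=
  ((h.memLp_apply i).mono_exponent (p := 2) (by norm_num)).integrable_mul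
    ((h.memLp_apply j).mono_exponent (p := 2) (by norm_num))

theorem integrable_norm_sq (h : IsMartingaleStep P m S X V Q C) :
    Integrable (fun ω => ‖X ω‖ ^ 2) P :=
  (h.memLp_increment.mono_exponent (p := 2) (by norm_num)).integrable_norm_pow'

theorem integrable_norm_pow_three (h : IsMartingaleStep P m S X V Q C) :
    Integrable (fun ω => ‖X ω‖ ^ 3) P :=
  h.memLp_increment.integrable_norm_pow'

/-- The pull-out property for the trace of the conditional covariance. -/
theorem integral_mul_trace (h : IsMartingaleStep P m S X V Q C) {a : Ω → ℝ}
    (ha : StronglyMeasurable[m] a) {K : ℝ} (hK : ∀ᵐ ω ∂P, ‖a ω‖ ≤ K) :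
    ∫ ω, a ω * (V ω).trace ∂P = ∫ ω, a ω * ‖X ω‖ ^ 2 ∂P := by
  have ham := (ha.mono h.le).aestronglyMeasurable (μ := P)
  have hint : ∀ i, Integrable (fun ω => a ω * (X ω i * X ω i)) P := fun i =>
    (h.integrable_apply_mul_apply i i).bdd_mul ham hK
  have hint' : ∀ i, Integrable (fun ω => a ω * V ω i i) P := fun i => by
    refine Integrable.bdd_mul ?_ ham hK
    rw [h.condCov_eq]
    exact integrable_condExp
  simp_rw [Matrix.trace, Matrix.diag_apply, EuclideanSpace.real_norm_sq_eq, pow_two,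
    Finset.mul_sum]
  rw [integral_finsetSum _ fun i _ => hint' i, integral_finsetSum _ fun i _ => hint i]
  refine Finset.sum_congr rfl fun i _ => ?_
  rw [← integral_mul_condExp h.le ha (hint i) (h.integrable_apply_mul_apply i i),
    ← h.condCov_eq i i]

theorem integrable_sqrt_trace_pow (h : IsMartingaleStep P m S X V Q C) :
    Integrable (fun ω => √(V ω).trace ^ 3) P := by
  refine Integrable.mono' (integrable_const (√C ^ 3))
    ((h.stronglyMeasurable_sqrt_trace.mono h.le).aestronglyMeasurable.pow 3) ?_
  filter_upwards [h.abs_sqrt_trace_le] with ω h1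
  rw [norm_pow]
  gcongr

/-- A conditional Jensen inequality, from Young's inequality `3 a b² ≤ a³ + 2 b³`. -/
theorem integral_sqrt_trace_pow_le (h : IsMartingaleStep P m S X V Q C) :
    ∫ ω, √(V ω).trace ^ 3 ∂P ≤ ∫ ω, ‖X ω‖ ^ 3 ∂P := by
  have e1 : ∫ ω, √(V ω).trace ^ 3 ∂P = ∫ ω, √(V ω).trace * ‖X ω‖ ^ 2 ∂P := by
    rw [← h.integral_mul_trace h.stronglyMeasurable_sqrt_trace h.abs_sqrt_trace_le]
    refine integral_congr_ae ?_
    -- Away from the positive semidefinite matrices, `√` would truncate a negative trace to `0`.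
    filter_upwards [h.posSemidef_condCov] with ω h1
    nth_rewrite 3 [← Real.sq_sqrt h1.trace_nonneg]
    ring
  have e2 : ∫ ω, √(V ω).trace * ‖X ω‖ ^ 2 ∂P ≤
      ∫ ω, (√(V ω).trace ^ 3 / 3 + ‖X ω‖ ^ 3 * 2 / 3) ∂P := by
    refine integral_mono_ae (h.integrable_norm_sq.bdd_mul
      (h.stronglyMeasurable_sqrt_trace.mono h.le).aestronglyMeasurable h.abs_sqrt_trace_le)
      ((h.integrable_sqrt_trace_pow.div_const 3).add
        ((h.integrable_norm_pow_three.mul_const 2).div_const 3)) (ae_of_all _ fun ω => ?_)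
    have ha := Real.sqrt_nonneg (V ω).trace
    have hb := norm_nonneg (X ω)
    nlinarith [mul_nonneg (sq_nonneg (√(V ω).trace - ‖X ω‖)) (by linarith :
      0 ≤ √(V ω).trace + 2 * ‖X ω‖)]
  rw [integral_add (h.integrable_sqrt_trace_pow.div_const 3)
    ((h.integrable_norm_pow_three.mul_const 2).div_const 3), integral_div, integral_div,
    integral_mul_const, ← e1] at e2
  linarith

theorem integrable_gaussianAverage_start (h : IsMartingaleStep P m S X V Q C)
    (hf : HasLipschitzFDeriv f M) :
    Integrable (fun ω => gaussianAverage f (Q ω + V ω) (S ω)) P := by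
  refine integrable_gaussianAverage hf (fun i j => ?_) ?_ h.trace_le
    (h.measurable_start.mono h.le le_rfl) h.memLp_start
  · exact ((h.measurable_rest i j).add (h.stronglyMeasurable_condCov i j).measurable).mono
      h.le le_rfl
  · filter_upwards [h.posSemidef_rest, h.posSemidef_condCov] with ω h1 h2 using h1.add h2

theorem integrable_gaussianAverage_end (h : IsMartingaleStep P m S X V Q C)
    (hf : HasLipschitzFDeriv f M) :
    Integrable (fun ω => gaussianAverage f (Q ω) (S ω + X ω)) P :=
  integrable_gaussianAverage hf (fun i j => (h.measurable_rest i j).mono h.le le_rfl)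
    h.posSemidef_rest h.trace_rest_le
    ((h.measurable_start.mono h.le le_rfl).add h.measurable_increment)
    (h.memLp_start.add (h.memLp_increment.mono_exponent (by norm_num)))

theorem integrable_linear_term (h : IsMartingaleStep P m S X V Q C)
    (hf : HasLipschitzFDeriv f M) (i : Fin d) :
    Integrable (fun ω => gaussianAverage (partialDeriv f i) (Q ω) (S ω) * X ω i) P := by
  have hm : MemLp (fun ω => gaussianAverage (partialDeriv f i) (Q ω) (S ω)) 2 P := by
    refine MemLp.mono' ((memLp_const ‖fderiv ℝ f 0‖).add
      ((h.memLp_start.norm.add (memLp_const (1 + C))).const_mul (M : ℝ)))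
      ((h.stronglyMeasurable_gaussianAverage
        (measurable_partialDeriv f i)).mono h.le).aestronglyMeasurable ?_
    filter_upwards [h.posSemidef_rest, h.trace_rest_le] with ω h1 h2
    refine (abs_gaussianAverage_partialDeriv_le hf h1 i (S ω)).trans ?_
    simp only [Pi.add_apply]
    gcongr
  exact hm.integrable_mul ((h.memLp_apply i).mono_exponent (p := 2) (by norm_num))

theorem integral_linear_term (h : IsMartingaleStep P m S X V Q C)
    (hf : HasLipschitzFDeriv f M) (i : Fin d) :
    ∫ ω, gaussianAverage (partialDeriv f i) (Q ω) (S ω) * X ω i ∂P = 0 := by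
  have hX := h.memLp_increment.integrable (by norm_num)
  rw [← integral_mul_condExp h.le (h.stronglyMeasurable_gaussianAverage
    (measurable_partialDeriv f i)) (h.integrable_linear_term hf i)
    ((h.memLp_apply i).integrable (by norm_num))]
  have h1 := (EuclideanSpace.proj (𝕜 := ℝ) i).comp_condExp_comm (m := m) hX
  refine integral_eq_zero_of_ae ?_
  filter_upwards [h1, h.condExp_increment] with ω h2 h3
  have h4 : (P[fun ω => X ω i | m]) ω = 0 := by
    have h5 : (P[fun ω => X ω i | m]) ω = EuclideanSpace.proj (𝕜 := ℝ) i ((P[X | m]) ω) := h2.symm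
    rw [h5, h3]
    simp
  simp [h4]

theorem integrable_quadratic_term (h : IsMartingaleStep P m S X V Q C)
    (hf : HasLipschitzFDeriv f M) (i j : Fin d) :
    Integrable (fun ω => (X ω i * X ω j - V ω i j) *
      gaussianAverage (partialDeriv₂ f i j) (Q ω) (S ω)) P := by
  refine Integrable.mul_bdd (c := M) ((h.integrable_apply_mul_apply i j).sub ?_)
    ((h.stronglyMeasurable_gaussianAverage
      (measurable_partialDeriv₂ f i j)).mono h.le).aestronglyMeasurable
    (ae_of_all _ fun ω => abs_gaussianAverage_partialDeriv₂_le hf _ _ _ _)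
  rw [h.condCov_eq]
  exact integrable_condExp

theorem integral_quadratic_term (h : IsMartingaleStep P m S X V Q C)
    (hf : HasLipschitzFDeriv f M) (i j : Fin d) :
    ∫ ω, (X ω i * X ω j - V ω i j) *
      gaussianAverage (partialDeriv₂ f i j) (Q ω) (S ω) ∂P = 0 := by
  have hB := h.stronglyMeasurable_gaussianAverage
    (measurable_partialDeriv₂ f i j)
  have hBm := (hB.mono h.le).aestronglyMeasurable (μ := P)
  have hb : ∀ᵐ ω ∂P, ‖gaussianAverage (partialDeriv₂ f i j) (Q ω) (S ω)‖ ≤ M :=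
    ae_of_all _ fun ω => abs_gaussianAverage_partialDeriv₂_le hf _ _ _ _
  have hXX := h.integrable_apply_mul_apply i j
  have hV : Integrable (fun ω => V ω i j) P := by
    rw [h.condCov_eq]
    exact integrable_condExp
  simp_rw [mul_comm _ (gaussianAverage (partialDeriv₂ f i j) _ _), mul_sub]
  rw [integral_sub (hXX.bdd_mul hBm hb) (hV.bdd_mul hBm hb),
    ← integral_mul_condExp h.le hB (hXX.bdd_mul hBm hb) hXX, ← h.condCov_eq, sub_self]

/-- The cost of replacing `X` by a Gaussian increment when at least `r I` is left in the
covariance of the future. -/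
theorem abs_integral_sub_le (h : IsMartingaleStep P m S X V Q C)
    (hf : HasLipschitzFDeriv f M) {r : ℝ} (hr : 0 < r)
    (hQr : ∀ᵐ ω ∂P, (Q ω - r • (1 : Matrix (Fin d) (Fin d) ℝ)).PosSemidef) :
    |∫ ω, gaussianAverage f (Q ω) (S ω + X ω) ∂P -
      ∫ ω, gaussianAverage f (Q ω + V ω) (S ω) ∂P| ≤
      M * ((1 + √3) / (6 * √r)) * ∫ ω, ‖X ω‖ ^ 3 ∂P := by
  have i0 : Integrable (fun ω => gaussianAverage f (Q ω) (S ω + X ω) -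
      gaussianAverage f (Q ω + V ω) (S ω)) P :=
    (h.integrable_gaussianAverage_end hf).sub (h.integrable_gaussianAverage_start hf)
  have i1 : Integrable (fun ω => ∑ i, X ω i * gaussianAverage (partialDeriv f i) (Q ω) (S ω)) P :=
    integrable_finsetSum _ fun i _ => by
      simpa only [mul_comm] using h.integrable_linear_term hf i
  have i2 : Integrable (fun ω => ∑ i, ∑ j, (X ω i * X ω j - V ω i j) *
      gaussianAverage (partialDeriv₂ f i j) (Q ω) (S ω)) P :=
    integrable_finsetSum _ fun i _ => integrable_finsetSum _ fun j _ =>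
      h.integrable_quadratic_term hf i j
  have e1 : ∫ ω, ∑ i, X ω i * gaussianAverage (partialDeriv f i) (Q ω) (S ω) ∂P = 0 := by
    rw [integral_finsetSum _ fun i _ => by
      simpa only [mul_comm] using h.integrable_linear_term hf i]
    refine Finset.sum_eq_zero fun i _ => ?_
    simpa only [mul_comm] using h.integral_linear_term hf i
  have e2 : ∫ ω, ∑ i, ∑ j, (X ω i * X ω j - V ω i j) *
      gaussianAverage (partialDeriv₂ f i j) (Q ω) (S ω) ∂P = 0 := by
    rw [integral_finsetSum _ fun i _ => integrable_finsetSum _ fun j _ =>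
      h.integrable_quadratic_term hf i j]
    refine Finset.sum_eq_zero fun i _ => ?_
    rw [integral_finsetSum _ fun j _ => h.integrable_quadratic_term hf i j]
    exact Finset.sum_eq_zero fun j _ => h.integral_quadratic_term hf i j
  have i01 : Integrable (fun ω => gaussianAverage f (Q ω) (S ω + X ω) -
      gaussianAverage f (Q ω + V ω) (S ω) -
      ∑ i, X ω i * gaussianAverage (partialDeriv f i) (Q ω) (S ω)) P := i0.sub i1
  have i3 : Integrable (fun ω => ‖X ω‖ ^ 3 + √3 * √(V ω).trace ^ 3) P :=
    h.integrable_norm_pow_three.add (h.integrable_sqrt_trace_pow.const_mul _)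
  have key := norm_integral_le_of_norm_le (μ := P)
    (f := fun ω => gaussianAverage f (Q ω) (S ω + X ω) -
      gaussianAverage f (Q ω + V ω) (S ω) -
      ∑ i, X ω i * gaussianAverage (partialDeriv f i) (Q ω) (S ω) -
      (∑ i, ∑ j, (X ω i * X ω j - V ω i j) *
        gaussianAverage (partialDeriv₂ f i j) (Q ω) (S ω)) / 2)
    (i3.const_mul (M / (6 * √r))) (by
      filter_upwards [hQr, h.posSemidef_rest, h.posSemidef_condCov] with ω h1 h2 h3
      exact abs_gaussianAverage_sub_le hf hr h2 h1 h3 (S ω) (X ω))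
  rw [integral_sub i01 (i2.div_const 2), integral_sub i0 i1,
    integral_sub (h.integrable_gaussianAverage_end hf) (h.integrable_gaussianAverage_start hf),
    integral_div, e1, e2, integral_const_mul, integral_add h.integrable_norm_pow_three
      (h.integrable_sqrt_trace_pow.const_mul _), integral_const_mul] at key
  simp only [sub_zero, zero_div, Real.norm_eq_abs] at key
  calc _ ≤ _ := key
    _ ≤ M / (6 * √r) * (∫ ω, ‖X ω‖ ^ 3 ∂P + √3 * ∫ ω, ‖X ω‖ ^ 3 ∂P) := by
        have := h.integral_sqrt_trace_pow_le
        gcongr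
    _ = _ := by ring

/-- The cost of replacing `X` by a Gaussian increment when no noise is left for the future. -/
theorem abs_integral_sub_le' (h : IsMartingaleStep P m S X V Q C)
    (hf : HasLipschitzFDeriv f M) {α : ℝ} (hα : 0 < α) (hV : ∀ᵐ ω ∂P, α ≤ (V ω).trace) :
    |∫ ω, gaussianAverage f (Q ω) (S ω + X ω) ∂P -
      ∫ ω, gaussianAverage f (Q ω + V ω) (S ω) ∂P| ≤
      M * (1 / √α) * ∫ ω, ‖X ω‖ ^ 3 ∂P := by
  have i0 : Integrable (fun ω => gaussianAverage f (Q ω) (S ω + X ω) -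
      gaussianAverage f (Q ω + V ω) (S ω)) P :=
    (h.integrable_gaussianAverage_end hf).sub (h.integrable_gaussianAverage_start hf)
  have i1 : Integrable (fun ω => ∑ i, X ω i * gaussianAverage (partialDeriv f i) (Q ω) (S ω)) P :=
    integrable_finsetSum _ fun i _ => by
      simpa only [mul_comm] using h.integrable_linear_term hf i
  have e1 : ∫ ω, ∑ i, X ω i * gaussianAverage (partialDeriv f i) (Q ω) (S ω) ∂P = 0 := by
    rw [integral_finsetSum _ fun i _ => by
      simpa only [mul_comm] using h.integrable_linear_term hf i]
    refine Finset.sum_eq_zero fun i _ => ?_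
    simpa only [mul_comm] using h.integral_linear_term hf i
  have i2 : Integrable (fun ω => (V ω).trace) P :=
    integrable_finsetSum _ fun i _ => by
      simp only [Matrix.diag_apply]
      rw [h.condCov_eq]
      exact integrable_condExp
  have e2 : ∫ ω, (V ω).trace ∂P = ∫ ω, ‖X ω‖ ^ 2 ∂P := by
    simpa using h.integral_mul_trace (a := fun _ => 1) stronglyMeasurable_const (K := 1) (by simp)
  have e3 : ∫ ω, (V ω).trace ∂P ≤ 1 / √α * ∫ ω, ‖X ω‖ ^ 3 ∂P := by
    refine le_trans ?_ (mul_le_mul_of_nonneg_left h.integral_sqrt_trace_pow_le (by positivity))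
    rw [← integral_const_mul]
    refine integral_mono_ae i2 (h.integrable_sqrt_trace_pow.const_mul _) ?_
    filter_upwards [hV] with ω h1
    have h2 : 0 < √α := Real.sqrt_pos.2 hα
    have h3 : √α ≤ √(V ω).trace := Real.sqrt_le_sqrt h1
    have h4 : √(V ω).trace ^ 2 = (V ω).trace := Real.sq_sqrt (hα.le.trans h1)
    rw [one_div, ← div_eq_inv_mul, le_div_iff₀ h2, pow_succ, h4]
    exact mul_le_mul_of_nonneg_left h3 (hα.le.trans h1)
  have key := norm_integral_le_of_norm_le (μ := P)
    (f := fun ω => gaussianAverage f (Q ω) (S ω + X ω) -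
      gaussianAverage f (Q ω + V ω) (S ω) -
      ∑ i, X ω i * gaussianAverage (partialDeriv f i) (Q ω) (S ω))
    ((h.integrable_norm_sq.add i2).const_mul (M / 2 : ℝ)) (by
      filter_upwards [h.posSemidef_rest, h.posSemidef_condCov] with ω h2 h3
      exact abs_gaussianAverage_sub_le' hf h2 h3 (S ω) (X ω))
  rw [integral_sub i0 i1,
    integral_sub (h.integrable_gaussianAverage_end hf) (h.integrable_gaussianAverage_start hf),
    e1, integral_const_mul, integral_add' h.integrable_norm_sq i2, ← e2] at key
  simp only [sub_zero, Real.norm_eq_abs] at key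
  calc _ ≤ _ := key
    _ = M * ∫ ω, (V ω).trace ∂P := by ring
    _ ≤ M * (1 / √α * ∫ ω, ‖X ω‖ ^ 3 ∂P) := by gcongr
    _ = _ := by ring

end IsMartingaleStep

end Probability

/-! ### Summation over the steps -/

section Telescoping

variable {Ω : Type*} {mΩ : MeasurableSpace Ω} {P : Measure Ω}
  {d n : ℕ} {X : ℕ → Ω → EuclideanSpace ℝ (Fin d)} {ℱ : Filtration ℕ mΩ}
  {A : Matrix (Fin d) (Fin d) ℝ} {α : ℝ}

/-- What is left of the total covariance `A` after `k` steps. It is known at time `k - 1`. -/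
noncomputable def remainingCov (X : ℕ → Ω → EuclideanSpace ℝ (Fin d)) (ℱ : Filtration ℕ mΩ)
    (P : Measure Ω) (A : Matrix (Fin d) (Fin d) ℝ) (k : ℕ) (ω : Ω) : Matrix (Fin d) (Fin d) ℝ :=
  A - ∑ i ∈ Finset.Icc 1 k, condCov X ℱ P i ω

theorem remainingCov_succ_add (X : ℕ → Ω → EuclideanSpace ℝ (Fin d)) (ℱ : Filtration ℕ mΩ)
    (P : Measure Ω) (A : Matrix (Fin d) (Fin d) ℝ) (k : ℕ) (ω : Ω) :
    remainingCov X ℱ P A (k + 1) ω + condCov X ℱ P (k + 1) ω = remainingCov X ℱ P A k ω := by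
  rw [remainingCov, remainingCov, Finset.sum_Icc_succ_top (by omega)]
  abel

theorem partialSum_succ (X : ℕ → Ω → EuclideanSpace ℝ (Fin d)) (k : ℕ) (ω : Ω) :
    partialSum X (k + 1) ω = partialSum X k ω + X (k + 1) ω := by
  rw [partialSum, partialSum, Finset.sum_Icc_succ_top (by omega)]

theorem posSemidef_remainingCov_sub {ω : Ω}
    (hsum : ∑ k ∈ Finset.Icc 1 n, condCov X ℱ P k ω = A)
    (hV : ∀ k ∈ Finset.Icc 1 n,
      (condCov X ℱ P k ω - α • (1 : Matrix (Fin d) (Fin d) ℝ)).PosSemidef) {k : ℕ} (hk : k ≤ n) :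
    (remainingCov X ℱ P A k ω -
      (((n - k : ℕ) : ℝ) * α) • (1 : Matrix (Fin d) (Fin d) ℝ)).PosSemidef := by
  have h1 : remainingCov X ℱ P A k ω = ∑ i ∈ Finset.Ioc k n, condCov X ℱ P i ω := by
    rw [remainingCov, ← hsum, sub_eq_iff_eq_add, add_comm]
    exact (Finset.sum_Ioc_consecutive (fun i => condCov X ℱ P i ω) k.zero_le hk).symm
  have h2 : (((n - k : ℕ) : ℝ) * α) • (1 : Matrix (Fin d) (Fin d) ℝ) =
      ∑ i ∈ Finset.Ioc k n, α • (1 : Matrix (Fin d) (Fin d) ℝ) := by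
    rw [Finset.sum_const, Nat.card_Ioc, mul_smul, Nat.cast_smul_eq_nsmul]
  rw [h1, h2, ← Finset.sum_sub_distrib]
  refine Matrix.posSemidef_sum _ fun i hi => hV i ?_
  simp only [Finset.mem_Ioc, Finset.mem_Icc] at hi ⊢
  omega

theorem posSemidef_of_sub_smul_one {B : Matrix (Fin d) (Fin d) ℝ} {r : ℝ} (hr : 0 ≤ r)
    (hB : (B - r • (1 : Matrix (Fin d) (Fin d) ℝ)).PosSemidef) : B.PosSemidef := by
  have := hB.add (Matrix.PosSemidef.one.smul hr)
  rwa [sub_add_cancel] at this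

theorem le_trace_of_posSemidef_sub {B : Matrix (Fin d) (Fin d) ℝ} (hd : 0 < d) {r : ℝ}
    (hr : 0 ≤ r) (hB : (B - r • (1 : Matrix (Fin d) (Fin d) ℝ)).PosSemidef) : r ≤ B.trace := by
  have h3 := hB.trace_nonneg
  rw [Matrix.trace_sub, Matrix.trace_smul, Matrix.trace_one, Fintype.card_fin, smul_eq_mul,
    sub_nonneg] at h3
  have h4 : (1 : ℝ) ≤ d := by exact_mod_cast hd
  nlinarith

theorem measurable_remainingCov_succ (k : ℕ) (i j : Fin d) :
    Measurable[ℱ k] fun ω => remainingCov X ℱ P A (k + 1) ω i j := by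
  simp only [remainingCov, Matrix.sub_apply, Matrix.sum_apply]
  refine measurable_const.sub (Finset.measurable_sum _ fun l hl => ?_)
  refine (stronglyMeasurable_condExp.mono (ℱ.mono ?_)).measurable
  simp only [Finset.mem_Icc] at hl
  omega

theorem measurable_partialSum (hX : IsMartingaleDifference n X ℱ P) {k : ℕ} (hk : k ≤ n) :
    Measurable[ℱ k] (partialSum X k) := by
  refine Finset.measurable_sum _ fun i hi => ?_
  simp only [Finset.mem_Icc] at hi
  exact ((hX.adapted i (by simp; omega)).mono (ℱ.mono (by omega))).measurable

theorem memLp_partialSum {p : ℝ≥0∞} (hX : ∀ k ∈ Finset.Icc 1 n, MemLp (X k) p P) {k : ℕ}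
    (hk : k ≤ n) : MemLp (partialSum X k) p P := by
  refine memLp_finsetSum _ fun i hi => hX i ?_
  simp only [Finset.mem_Icc] at hi ⊢
  omega

variable [IsProbabilityMeasure P]

theorem isMartingaleStep (hX : IsMartingaleDifference n X ℱ P)
    (hX3 : ∀ k ∈ Finset.Icc 1 n, MemLp (X k) 3 P)
    (hvar : ∀ᵐ ω ∂P, ∑ k ∈ Finset.Icc 1 n, condCov X ℱ P k ω = A) (hα : 0 < α)
    (hV : ∀ᵐ ω ∂P, ∀ k ∈ Finset.Icc 1 n,
      (condCov X ℱ P k ω - α • (1 : Matrix (Fin d) (Fin d) ℝ)).PosSemidef) {k : ℕ} (hk : k < n) :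
    IsMartingaleStep P (ℱ k) (partialSum X k) (X (k + 1)) (condCov X ℱ P (k + 1))
      (remainingCov X ℱ P A (k + 1)) A.trace where
  le := ℱ.le k
  memLp_increment := hX3 _ (by simp; omega)
  measurable_increment := ((hX.adapted (k + 1) (by simp; omega)).mono (ℱ.le _)).measurable
  condExp_increment := hX.condExp_eq_zero (k + 1) (by simp; omega)
  condCov_eq _ _ := rfl
  measurable_start := measurable_partialSum hX hk.le
  memLp_start := memLp_partialSum (fun k hk => (hX3 k hk).mono_exponent (by norm_num)) hk.le
  measurable_rest := measurable_remainingCov_succ k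
  posSemidef_rest := by
    filter_upwards [hvar, hV] with ω h1 h2
    exact posSemidef_of_sub_smul_one (by positivity) (posSemidef_remainingCov_sub h1 h2 hk)
  posSemidef_condCov := by
    filter_upwards [hV] with ω h2
    exact posSemidef_of_sub_smul_one hα.le (h2 (k + 1) (by simp; omega))
  trace_le := by
    filter_upwards [hV] with ω h2
    rw [remainingCov_succ_add, remainingCov, Matrix.trace_sub, sub_le_self_iff]
    refine (Matrix.posSemidef_sum _ fun i hi => ?_).trace_nonneg
    simp only [Finset.mem_Icc] at hi
    exact posSemidef_of_sub_smul_one hα.le (h2 i (by simp; omega))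

theorem sum_inv_sqrt_le (N : ℕ) : ∑ i ∈ Finset.range N, 1 / √((i + 1 : ℕ) : ℝ) ≤ 2 * √N := by
  induction N with
  | zero => simp
  | succ N ih =>
    rw [Finset.sum_range_succ]
    have h0 : 0 < √((N + 1 : ℕ) : ℝ) := Real.sqrt_pos.2 (by positivity)
    have h1 : √((N + 1 : ℕ) : ℝ) ^ 2 = N + 1 := by rw [Real.sq_sqrt (by positivity)]; push_cast; rfl
    have h2 : √(N : ℝ) ^ 2 = N := Real.sq_sqrt (by positivity)
    have h3 : 1 / √((N + 1 : ℕ) : ℝ) ≤ 2 * √((N + 1 : ℕ) : ℝ) - 2 * √N := by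
      rw [div_le_iff₀ h0]
      nlinarith [sq_nonneg (√((N + 1 : ℕ) : ℝ) - √(N : ℝ))]
    linarith

/-- The weights of the single steps add up to at most `(3 π / 4) √(N + 1)`: the `i`-th step from
the end is smoothed by at least `i` Gaussian increments, the last one by none. -/
theorem sum_step_weights_le (N : ℕ) :
    (∑ i ∈ Finset.range N, (1 + √3) / (6 * √((i + 1 : ℕ) : ℝ))) + 1 ≤
      3 * Real.pi / 4 * √((N + 1 : ℕ) : ℝ) := by
  have h1 : ∑ i ∈ Finset.range N, (1 + √3) / (6 * √((i + 1 : ℕ) : ℝ)) =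
      (1 + √3) / 6 * ∑ i ∈ Finset.range N, 1 / √((i + 1 : ℕ) : ℝ) := by
    rw [Finset.mul_sum]
    refine Finset.sum_congr rfl fun i _ => ?_
    rw [div_mul_div_comm, mul_one]
  have h2 := mul_le_mul_of_nonneg_left (sum_inv_sqrt_le N)
    (by positivity : 0 ≤ (1 + √3) / 6)
  have h3 : √3 ≤ 1.8 := Real.sqrt_le_iff.2 (by norm_num)
  have h4 : √(N : ℝ) ≤ √((N + 1 : ℕ) : ℝ) := Real.sqrt_le_sqrt (by push_cast; linarith)
  have h5 : 1 ≤ √((N + 1 : ℕ) : ℝ) := Real.one_le_sqrt.2 (by simp)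
  have h6 : (1 + √3) / 6 * (2 * √(N : ℝ)) ≤ (1 + 1.8) / 6 * (2 * √((N + 1 : ℕ) : ℝ)) := by gcongr
  have h7 := Real.pi_gt_d2
  rw [h1]
  nlinarith

theorem abs_integral_partialSum_sub_gaussianAverage_le {f : EuclideanSpace ℝ (Fin d) → ℝ}
    {M : NNReal} (hf : HasLipschitzFDeriv f M) (hd : 0 < d) (hn : 1 ≤ n)
    (hX : IsMartingaleDifference n X ℱ P)
    (hX3 : ∀ k ∈ Finset.Icc 1 n, MemLp (X k) 3 P)
    (hvar : ∀ᵐ ω ∂P, ∑ k ∈ Finset.Icc 1 n, condCov X ℱ P k ω = A) (hα : 0 < α)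
    (hV : ∀ᵐ ω ∂P, ∀ k ∈ Finset.Icc 1 n,
      (condCov X ℱ P k ω - α • (1 : Matrix (Fin d) (Fin d) ℝ)).PosSemidef)
    {G : ℝ} (hG : ∀ k ∈ Finset.Icc 1 n, ∫ ω, ‖X k ω‖ ^ 3 ∂P ≤ G) :
    |∫ ω, f (partialSum X n ω) ∂P - gaussianAverage f A 0| ≤
      3 * Real.pi / 4 * √n * (M * G / √α) := by
  obtain ⟨N, rfl⟩ : ∃ N, n = N + 1 := ⟨n - 1, by omega⟩
  have hG0 : 0 ≤ G := le_trans (by positivity) (hG 1 (by simp))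
  set T : ℕ → ℝ := fun k =>
    ∫ ω, gaussianAverage f (remainingCov X ℱ P A k ω) (partialSum X k ω) ∂P with hT
  have hT0 : T 0 = gaussianAverage f A 0 := by simp [hT, remainingCov, partialSum]
  have hTn : T (N + 1) = ∫ ω, f (partialSum X (N + 1) ω) ∂P := by
    refine integral_congr_ae ?_
    filter_upwards [hvar] with ω h1
    rw [remainingCov, h1, sub_self, gaussianAverage_zero]
  have hsmooth : ∀ k < N, |T (k + 1) - T k| ≤
      (1 + √3) / (6 * √((N - 1 - k + 1 : ℕ) : ℝ)) * (M * G / √α) := fun k hk => by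
    have hs := isMartingaleStep hX hX3 hvar hα hV (k := k) (by omega)
    have hr : 0 < ((N + 1 - (k + 1) : ℕ) : ℝ) * α :=
      mul_pos (Nat.cast_pos.2 (by omega)) hα
    have := hs.abs_integral_sub_le hf hr (by
      filter_upwards [hvar, hV] with ω h1 h2
      exact posSemidef_remainingCov_sub h1 h2 (by omega))
    simp only [remainingCov_succ_add, ← partialSum_succ] at this
    refine this.trans ?_
    rw [show N + 1 - (k + 1) = N - 1 - k + 1 by omega, Real.sqrt_mul (by positivity)]
    have h2 := hG (k + 1) (by simp; omega)
    calc _ ≤ M * ((1 + √3) / (6 * (√((N - 1 - k + 1 : ℕ) : ℝ) * √α))) * G := by gcongr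
      _ = _ := by
        have : 0 < √α := Real.sqrt_pos.2 hα
        have : 0 < √((N - 1 - k + 1 : ℕ) : ℝ) := Real.sqrt_pos.2 (by positivity)
        field_simp
  have hlast : |T (N + 1) - T N| ≤ M * G / √α := by
    have hs := isMartingaleStep hX hX3 hvar hα hV (k := N) (by omega)
    have := hs.abs_integral_sub_le' hf hα (by
      filter_upwards [hV] with ω h2
      exact le_trace_of_posSemidef_sub hd hα.le (h2 (N + 1) (by simp)))
    simp only [remainingCov_succ_add, ← partialSum_succ] at this
    refine this.trans ?_
    have h2 := hG (N + 1) (by simp)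
    calc _ ≤ M * (1 / √α) * G := by gcongr
      _ = _ := by ring
  have htel : T (N + 1) - T 0 = (∑ k ∈ Finset.range N, (T (k + 1) - T k)) + (T (N + 1) - T N) := by
    rw [Finset.sum_range_sub]
    ring
  rw [← hTn, ← hT0, htel]
  calc _ ≤ (∑ k ∈ Finset.range N, |T (k + 1) - T k|) + |T (N + 1) - T N| :=
        (abs_add_le _ _).trans (by gcongr; exact Finset.abs_sum_le_sum_abs _ _)
    _ ≤ (∑ k ∈ Finset.range N, (1 + √3) / (6 * √((N - 1 - k + 1 : ℕ) : ℝ)) * (M * G / √α)) +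
          M * G / √α := by
        gcongr with k hk
        exact hsmooth k (Finset.mem_range.1 hk)
    _ = ((∑ k ∈ Finset.range N, (1 + √3) / (6 * √((k + 1 : ℕ) : ℝ))) + 1) * (M * G / √α) := by
        rw [← Finset.sum_mul, Finset.sum_range_reflect
          (fun k => (1 + √3) / (6 * √((k + 1 : ℕ) : ℝ)))]
        ring
    _ ≤ _ := by
        gcongr
        exact sum_step_weights_le N

end Telescoping

/-! ### The test function -/

section TestFunction

variable {d : ℕ} {h : EuclideanSpace ℝ (Fin d) → ℝ}

theorem norm_gradient_sub_le (hM : M₂ h < ∞) (x y : EuclideanSpace ℝ (Fin d)) :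
    ‖∇ h x - ∇ h y‖ ≤ (M₂ h).toNNReal * ‖x - y‖ := by
  rcases eq_or_ne x y with rfl | hxy
  · simp
  have h1 : ‖∇ h x - ∇ h y‖ₑ / ‖x - y‖ₑ ≤ M₂ h :=
    le_iSup_of_le x (le_iSup_of_le y (le_iSup_of_le hxy le_rfl))
  rw [ENNReal.div_le_iff (by simpa [sub_eq_zero] using hxy) (by simp),
    ← ENNReal.coe_toNNReal hM.ne] at h1
  have h2 : ‖∇ h x - ∇ h y‖₊ ≤ (M₂ h).toNNReal * ‖x - y‖₊ := by
    rw [enorm_eq_nnnorm, enorm_eq_nnnorm] at h1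
    exact_mod_cast h1
  exact_mod_cast h2

theorem hasLipschitzFDeriv_of_M₂_lt_top (hh : Differentiable ℝ h)
    (hh' : Differentiable ℝ (∇ h)) (hM : M₂ h < ∞) : HasLipschitzFDeriv h (M₂ h).toNNReal := by
  have heq : fderiv ℝ h = fun x => innerSL ℝ (∇ h x) := by
    ext x v
    rw [innerSL_apply_apply, gradient, InnerProductSpace.toDual_symm_apply]
  refine ⟨hh, ?_, LipschitzWith.of_dist_le_mul fun x y => ?_⟩
  · rw [heq]
    exact (innerSL ℝ).differentiable.comp hh'
  · rw [heq, dist_eq_norm, dist_eq_norm, ← map_sub, innerSL_apply_norm]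
    exact norm_gradient_sub_le hM x y

theorem HasLipschitzFDeriv.comp_continuousLinearMap {M K : NNReal}
    (hf : HasLipschitzFDeriv h M)
    (T : EuclideanSpace ℝ (Fin d) →L[ℝ] EuclideanSpace ℝ (Fin d)) (hT : ‖T‖ ^ 2 ≤ K) :
    HasLipschitzFDeriv (fun x => h (T x)) (M * K) := by
  have heq : fderiv ℝ (fun x => h (T x)) = fun x => (fderiv ℝ h (T x)).comp T := by
    ext1 x
    rw [fderiv_fun_comp x (hf.differentiable (T x)) T.differentiableAt, T.fderiv]
  refine ⟨hf.differentiable.comp T.differentiable, ?_, LipschitzWith.of_dist_le_mul fun x y => ?_⟩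
  · rw [heq]
    exact (hf.differentiable_fderiv.comp T.differentiable).clm_comp (differentiable_const T)
  · rw [heq, dist_eq_norm, dist_eq_norm, ← ContinuousLinearMap.sub_comp]
    calc _ ≤ ‖fderiv ℝ h (T x) - fderiv ℝ h (T y)‖ * ‖T‖ := ContinuousLinearMap.opNorm_comp_le _ _
      _ ≤ M * (‖T‖ * ‖x - y‖) * ‖T‖ := by
          gcongr
          refine (hf.lipschitz.norm_sub_le _ _).trans ?_
          rw [← map_sub]
          gcongr
          exact T.le_opNorm _
      _ = M * ‖T‖ ^ 2 * ‖x - y‖ := by ring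
      _ ≤ _ := by
          push_cast
          gcongr

end TestFunction

/-! ### Normalization by the inverse square root -/

section Normalization

variable {d : ℕ} {A : Matrix (Fin d) (Fin d) ℝ}

theorem isUnit_det_sqrt (hA : A.PosDef) : IsUnit (CFC.sqrt A).det := by
  have h := CFC.sqrt_mul_sqrt_self A hA.posSemidef.nonneg
  have h2 := hA.det_pos
  rw [← h, Matrix.det_mul] at h2
  exact (left_ne_zero_of_mul h2.ne').isUnit

theorem norm_sq_sqrt_apply (hA : A.PosSemidef) (y : EuclideanSpace ℝ (Fin d)) :
    ‖Matrix.toEuclideanCLM (𝕜 := ℝ) (CFC.sqrt A) y‖ ^ 2 = y ⬝ᵥ A *ᵥ y := by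
  have hsa : IsSelfAdjoint (Matrix.toEuclideanCLM (𝕜 := ℝ) (CFC.sqrt A)) :=
    (CFC.sqrt_nonneg A).isSelfAdjoint.map _
  rw [← real_inner_self_eq_norm_sq, ← ContinuousLinearMap.adjoint_inner_right,
    hsa.adjoint_eq, ← ContinuousLinearMap.comp_apply, ← ContinuousLinearMap.mul_def, ← map_mul,
    CFC.sqrt_mul_sqrt_self _ hA.nonneg, Matrix.inner_toEuclideanCLM]

theorem posDef_of_sub_smul_one {r : ℝ} (hr : 0 < r)
    (hA : (A - r • (1 : Matrix (Fin d) (Fin d) ℝ)).PosSemidef) : A.PosDef := by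
  have := (Matrix.PosDef.one (n := Fin d) (R := ℝ)).smul hr
  simpa using Matrix.PosDef.posSemidef_add hA this

theorem sq_norm_inv_sqrt_le {r : ℝ} (hr : 0 < r)
    (hA : (A - r • (1 : Matrix (Fin d) (Fin d) ℝ)).PosSemidef) :
    ‖Matrix.toEuclideanCLM (𝕜 := ℝ) (CFC.sqrt A)⁻¹‖ ^ 2 ≤ r⁻¹ := by
  have hpd : A.PosDef := posDef_of_sub_smul_one hr hA
  have hle : ‖Matrix.toEuclideanCLM (𝕜 := ℝ) (CFC.sqrt A)⁻¹‖ ≤ √r⁻¹ := by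
    refine ContinuousLinearMap.opNorm_le_bound _ (Real.sqrt_nonneg _) fun x => ?_
    refine abs_le_of_sq_le_sq' ?_ (by positivity) |>.2
    set y := Matrix.toEuclideanCLM (𝕜 := ℝ) (CFC.sqrt A)⁻¹ x with hy
    have hx : Matrix.toEuclideanCLM (𝕜 := ℝ) (CFC.sqrt A) y = x := by
      rw [hy, ← ContinuousLinearMap.comp_apply, ← ContinuousLinearMap.mul_def, ← map_mul,
        Matrix.mul_nonsing_inv _ (isUnit_det_sqrt hpd), map_one]
      rfl
    have h1 := norm_sq_sqrt_apply hpd.posSemidef y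
    have h2 := hA.dotProduct_mulVec_nonneg y.ofLp
    have h3 : y.ofLp ⬝ᵥ y.ofLp = ‖y‖ ^ 2 := by
      rw [EuclideanSpace.real_norm_sq_eq]
      simp [dotProduct, pow_two]
    simp only [star_trivial, Matrix.sub_mulVec, Matrix.smul_mulVec, Matrix.one_mulVec,
      dotProduct_sub, dotProduct_smul, smul_eq_mul, h3] at h2
    rw [hx] at h1
    rw [mul_pow, Real.sq_sqrt (by positivity), h1, ← div_eq_inv_mul, le_div_iff₀ hr]
    linarith
  calc _ ≤ √r⁻¹ ^ 2 := by gcongr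
    _ = r⁻¹ := Real.sq_sqrt (by positivity)

/-- Normalizing by `A^{-1/2}` turns the Gaussian with covariance `A` into the standard one. -/
theorem gaussianAverage_invSqrtMul (hA : A.PosDef) {h : EuclideanSpace ℝ (Fin d) → ℝ}
    (hh : Continuous h) :
    gaussianAverage (fun x => h (invSqrtMul A x)) A 0 =
      ∫ z, h z ∂(multivariateGaussian 0 (1 : Matrix (Fin d) (Fin d) ℝ)) := by
  have hc : Continuous fun x => h (invSqrtMul A (0 + x)) := by
    unfold invSqrtMul
    fun_prop
  rw [gaussianAverage, multivariateGaussian_zero_one, multivariateGaussian,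
    integral_map (by fun_prop) hc.aestronglyMeasurable]
  congr 1
  ext z
  rw [invSqrtMul, zero_add, zero_add, ← ContinuousLinearMap.comp_apply,
    ← ContinuousLinearMap.mul_def, ← map_mul, Matrix.nonsing_inv_mul _ (isUnit_det_sqrt hA),
    map_one]
  rfl

theorem memLp_invSqrtMul (A : Matrix (Fin d) (Fin d) ℝ) {Ω : Type*} {mΩ : MeasurableSpace Ω}
    {P : Measure Ω} {S : Ω → EuclideanSpace ℝ (Fin d)} {p : ℝ≥0∞} (hS : MemLp S p P) :
    MemLp (fun ω => invSqrtMul A (S ω)) p P :=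
  (Matrix.toEuclideanCLM (𝕜 := ℝ) (CFC.sqrt A)⁻¹).comp_memLp' hS

end Normalization

/-! ### The error bound for the normalized sum -/

section NormalizedSum

variable {Ω : Type*} {mΩ : MeasurableSpace Ω} {P : Measure Ω} [IsProbabilityMeasure P]
  {d n : ℕ} {X : ℕ → Ω → EuclideanSpace ℝ (Fin d)} {ℱ : Filtration ℕ mΩ}
  {A : Matrix (Fin d) (Fin d) ℝ} {α : ℝ}

/-- The third moments are bounded away from zero, so any admissible `γ` is positive. -/
theorem sqrt_pow_three_le_integral (hd : 0 < d) (hn : 1 ≤ n)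
    (hX : IsMartingaleDifference n X ℱ P)
    (hX3 : ∀ k ∈ Finset.Icc 1 n, MemLp (X k) 3 P)
    (hvar : ∀ᵐ ω ∂P, ∑ k ∈ Finset.Icc 1 n, condCov X ℱ P k ω = A) (hα : 0 < α)
    (hV : ∀ᵐ ω ∂P, ∀ k ∈ Finset.Icc 1 n,
      (condCov X ℱ P k ω - α • (1 : Matrix (Fin d) (Fin d) ℝ)).PosSemidef) :
    √α ^ 3 ≤ ∫ ω, ‖X 1 ω‖ ^ 3 ∂P := by
  have hs := isMartingaleStep hX hX3 hvar hα hV (k := 0) (by omega)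
  refine le_trans ?_ hs.integral_sqrt_trace_pow_le
  have h1 : ∫ _, √α ^ 3 ∂P = √α ^ 3 := by simp
  rw [← h1]
  refine integral_mono_ae (integrable_const _) hs.integrable_sqrt_trace_pow ?_
  filter_upwards [hV] with ω h2
  gcongr
  exact le_trace_of_posSemidef_sub hd hα.le (h2 1 (by simp; omega))

/-- The error bound for the normalized sum, in terms of a bound `G` for the third moments. -/
theorem abs_integral_invSqrtMul_partialSum_sub_le {h : EuclideanSpace ℝ (Fin d) → ℝ}
    {M : NNReal} (hf : HasLipschitzFDeriv h M) (hd : 0 < d) (hn : 1 ≤ n)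
    (hX : IsMartingaleDifference n X ℱ P)
    (hX3 : ∀ k ∈ Finset.Icc 1 n, MemLp (X k) 3 P)
    (hvar : ∀ᵐ ω ∂P, ∑ k ∈ Finset.Icc 1 n, condCov X ℱ P k ω = A) (hα : 0 < α)
    (hV : ∀ᵐ ω ∂P, ∀ k ∈ Finset.Icc 1 n,
      (condCov X ℱ P k ω - α • (1 : Matrix (Fin d) (Fin d) ℝ)).PosSemidef)
    {G : ℝ} (hG : ∀ k ∈ Finset.Icc 1 n, ∫ ω, ‖X k ω‖ ^ 3 ∂P ≤ G) :
    |∫ ω, h (invSqrtMul A (partialSum X n ω)) ∂P -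
      ∫ z, h z ∂(multivariateGaussian 0 (1 : Matrix (Fin d) (Fin d) ℝ))| ≤
      3 * Real.pi / 4 * (M * G * √α / (α ^ 2 * √n)) := by
  have hn0 : (0 : ℝ) < n := Nat.cast_pos.2 hn
  have hnα : 0 < (n : ℝ) * α := mul_pos hn0 hα
  obtain ⟨ω, h1, h2⟩ := (hvar.and hV).exists
  have hA : (A - ((n : ℝ) * α) • (1 : Matrix (Fin d) (Fin d) ℝ)).PosSemidef := by
    have := posSemidef_remainingCov_sub h1 h2 (k := 0) n.zero_le
    simpa [remainingCov] using this
  have hpd : A.PosDef := posDef_of_sub_smul_one hnα hA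
  rw [← gaussianAverage_invSqrtMul hpd hf.differentiable.continuous]
  have hf' := hf.comp_continuousLinearMap (K := ((n * α)⁻¹ : ℝ).toNNReal)
    (Matrix.toEuclideanCLM (𝕜 := ℝ) (CFC.sqrt A)⁻¹) (by
      rw [Real.coe_toNNReal _ (by positivity)]
      exact sq_norm_inv_sqrt_le hnα hA)
  refine (abs_integral_partialSum_sub_gaussianAverage_le hf' hd hn hX hX3 hvar hα hV hG).trans
    (le_of_eq ?_)
  rw [NNReal.coe_mul, Real.coe_toNNReal _ (by positivity)]
  have e1 : (n : ℝ) = √n ^ 2 := (Real.sq_sqrt hn0.le).symm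
  have e2 : α = √α ^ 2 := (Real.sq_sqrt hα.le).symm
  have p1 : 0 < √(n : ℝ) := Real.sqrt_pos.2 hn0
  have p2 : 0 < √α := Real.sqrt_pos.2 hα
  generalize √(n : ℝ) = s at *
  generalize √α = t at *
  rw [e1, e2]
  field_simp

end NormalizedSum

theorem error_bound_le {d n α β γ M : ℝ} (hd : 1 ≤ d) (hn : 0 < n) (hα : 0 < α) (hαβ : α ≤ β)
    (hγ : 0 ≤ γ) (hM : 0 ≤ M) :
    3 * Real.pi / 4 * (M * (γ * d ^ (3 / 2 : ℝ)) * √α / (α ^ 2 * √n)) ≤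
      3 * Real.pi * γ * √β / (4 * α ^ 2) * M * (d ^ 2 / √n) := by
  have h1 : d ^ (3 / 2 : ℝ) ≤ d ^ 2 := by
    rw [← Real.rpow_natCast d 2]
    exact Real.rpow_le_rpow_of_exponent_le hd (by norm_num)
  have h3 : 0 < √n := Real.sqrt_pos.2 hn
  calc _ ≤ 3 * Real.pi / 4 * (M * (γ * d ^ 2) * √β / (α ^ 2 * √n)) := by gcongr
    _ = _ := by field_simp

end MartingaleCLT

theorem corollary1
    {Ω : Type*} {mΩ : MeasurableSpace Ω} (P : Measure Ω) [IsProbabilityMeasure P]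
    {Ω' : Type*} {mΩ' : MeasurableSpace Ω'} (P' : Measure Ω') [IsProbabilityMeasure P']
    (d n : ℕ) (hn : 1 ≤ n)
    (X : ℕ → Ω → EuclideanSpace ℝ (Fin d)) (ℱ : Filtration ℕ mΩ)
    (hX : MartingaleCLT.IsMartingaleDifference n X ℱ P)
    (hvar : ∀ᵐ ω ∂P, ∑ k ∈ Finset.Icc 1 n, MartingaleCLT.condCov X ℱ P k ω =
      MartingaleCLT.covMat (MartingaleCLT.partialSum X n) P)
    (α β γ : ℝ) (hα : 0 < α)
    (hV : ∀ k ∈ Finset.Icc 1 n, ∀ᵐ ω ∂P,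
      (MartingaleCLT.condCov X ℱ P k ω - α • (1 : Matrix (Fin d) (Fin d) ℝ)).PosSemidef ∧
      (β • (1 : Matrix (Fin d) (Fin d) ℝ) - MartingaleCLT.condCov X ℱ P k ω).PosSemidef)
    (hX3 : ∀ k ∈ Finset.Icc 1 n, MemLp (X k) 3 P)
    (hγ : ∀ k ∈ Finset.Icc 1 n, ∫ ω, ‖X k ω‖ ^ 3 ∂P ≤ γ * (d : ℝ) ^ (3 / 2 : ℝ))
    (Z : Ω' → EuclideanSpace ℝ (Fin d)) (hZ : HasLaw Z (multivariateGaussian 0 1) P')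
    (h : EuclideanSpace ℝ (Fin d) → ℝ)
    (hh : Differentiable ℝ h) (hh' : Differentiable ℝ (∇ h)) :
    (MartingaleCLT.M₂ h < ∞ →
      Integrable (fun ω => h (MartingaleCLT.invSqrtMul
        (MartingaleCLT.covMat (MartingaleCLT.partialSum X n) P)
        (MartingaleCLT.partialSum X n ω))) P ∧
      Integrable (fun ω' => h (Z ω')) P') ∧
    ENNReal.ofReal |∫ ω, h (MartingaleCLT.invSqrtMul
        (MartingaleCLT.covMat (MartingaleCLT.partialSum X n) P)
        (MartingaleCLT.partialSum X n ω)) ∂P - ∫ ω', h (Z ω') ∂P'| ≤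
      ENNReal.ofReal (3 * Real.pi * γ * √β / (4 * α ^ 2)) * MartingaleCLT.M₂ h *
        ENNReal.ofReal ((d : ℝ) ^ 2 / √(n : ℝ)) := by
  -- In dimension zero `h` is constant and both sides vanish.
  rcases Nat.eq_zero_or_pos d with rfl | hd
  · have hconst : ∀ x, h x = h 0 := fun x => congrArg h (Subsingleton.elim x 0)
    simp_rw [hconst]
    simp
  have hV' : ∀ᵐ ω ∂P, ∀ k ∈ Finset.Icc 1 n, (MartingaleCLT.condCov X ℱ P k ω -
      α • (1 : Matrix (Fin d) (Fin d) ℝ)).PosSemidef :=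
    (Finset.eventually_all _).2 fun k hk => (hV k hk).mono fun ω hω => hω.1
  have hαβ : α ≤ β := by
    obtain ⟨ω, h1, h2⟩ := (hV 1 (by simpa using hn)).exists
    have h3 := (h1.add h2).diag_nonneg (i := ⟨0, hd⟩)
    simp at h3
    linarith
  have hd0 : (0 : ℝ) < d := Nat.cast_pos.2 hd
  have hn0 : (0 : ℝ) < n := Nat.cast_pos.2 hn
  have hγ0 : 0 < γ := by
    have h1 := (MartingaleCLT.sqrt_pow_three_le_integral hd hn hX hX3 hvar hα hV').trans
      (hγ 1 (by simpa using hn))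
    have h2 : 0 < √α ^ 3 := pow_pos (Real.sqrt_pos.2 hα) 3
    exact pos_of_mul_pos_left (h2.trans_le h1) (by positivity)
  have hc : 0 < 3 * Real.pi * γ * √β / (4 * α ^ 2) := by
    have := Real.sqrt_pos.2 (hα.trans_le hαβ)
    have := Real.pi_pos
    positivity
  have hdn : 0 < (d : ℝ) ^ 2 / √(n : ℝ) := div_pos (by positivity) (Real.sqrt_pos.2 hn0)
  -- If `M₂ h = ∞`, the positivity of the other two factors keeps the right-hand side infinite.
  rcases eq_or_ne (MartingaleCLT.M₂ h) ∞ with hM | hM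
  · refine ⟨fun h => absurd hM h.ne, ?_⟩
    rw [hM, ENNReal.mul_top (ENNReal.ofReal_pos.2 hc).ne',
      ENNReal.top_mul (ENNReal.ofReal_pos.2 hdn).ne']
    exact le_top
  have hf := MartingaleCLT.hasLipschitzFDeriv_of_M₂_lt_top hh hh' hM.lt_top
  have hS : MemLp (MartingaleCLT.partialSum X n) 2 P := MartingaleCLT.memLp_partialSum
    (fun k hk => (hX3 k hk).mono_exponent (by norm_num)) le_rfl
  refine ⟨fun _ => ⟨hf.integrable_comp (MartingaleCLT.memLp_invSqrtMul _ hS), ?_⟩, ?_⟩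
  · refine hf.integrable_comp ?_
    have h1 := MartingaleCLT.memLp_id_multivariateGaussian (1 : Matrix (Fin d) (Fin d) ℝ)
      (p := 2) (by simp)
    rw [← hZ.map_eq] at h1
    exact h1.comp_of_map hZ.aemeasurable
  have hZ' : ∫ ω', h (Z ω') ∂P' = ∫ z, h z ∂(multivariateGaussian 0 1) :=
    hZ.integral_comp (f := h) hf.differentiable.continuous.aestronglyMeasurable
  have key :=
    MartingaleCLT.abs_integral_invSqrtMul_partialSum_sub_le hf hd hn hX hX3 hvar hα hV' hγ
  rw [hZ', ← ENNReal.ofReal_toReal hM, ← ENNReal.ofReal_mul hc.le,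
    ← ENNReal.ofReal_mul (mul_nonneg hc.le ENNReal.toReal_nonneg)]
  refine ENNReal.ofReal_le_ofReal (key.trans ?_)
  exact MartingaleCLT.error_bound_le (by exact_mod_cast hd) hn0 hα hαβ hγ0.le
    ENNReal.toReal_nonneg
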